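/- Let $d\ge 1$, let $L_2([-\pi,\pi]^d)$ and $L_2(\mathbb R^d)$ be the complex spaces, and put $e_n(x)=(2\pi)^{-d/2}e^{i\langle x,n\rangle}$ for $n\in\mathbb Z^d$ (an orthonormal basis of $L_2([-\pi,\pi]^d)$) and $C_{\ell,d}=\{-\ell,\dots,\ell\}^d$ for $\ell\ge 1$. Let $(t_n)_{n\in\mathbb Z^d}\subset\mathbb R^d$ be such that the exponentials $f_n(x)=(2\pi)^{-d/2}e^{i\langle x,t_n\rangle}$ form a uniformly invertible Riesz basis of $L_2([-\pi,\pi]^d)$. This means: $(f_n)_n$ is a Riesz basis, that is, the image of an orthonormal basis under an onto isomorphism, and for the isomorphism $L$ of $L_2([-\pi,\pi]^d)$ onto itself with $Le_n=f_n$ the finite matrices $\big(\langle Le_n,e_m\rangle\big)_{m,n\in C_{\ell,d}}$ are invertible for all $\ell\ge1$, and their inverses are bounded in operator norm (for the Euclidean norm) uniformly in $\ell$. Let $PW_{[-\pi,\pi]^d}$ be the space of all $f\in L_2(\mathbb R^d)$ whose inverse Fourier transform $(2\pi)^{-d/2}\int_{\mathbb R^d} f(\xi)e^{i\langle \cdot,\xi\rangle}\,d\xi$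 (in the $L_2$ sense) is supported in $[-\pi,\pi]^d$; each such $f$ is identified with its continuous representative. Then for every $f\in PW_{[-\pi,\pi]^d}$ and every $\ell\ge 1$ there is a unique polynomial $\Psi_\ell$ in $d$ variables with complex coefficients which has degree at most $2\ell$ in each variable and satisfies $\Psi_\ell(t_n)=f(t_n)$ for all $n\in C_{\ell,d}$; and for every $A>0$, $$\lim_{\ell\to\infty}\big\|f-\Psi_\ell\big\|_{L_2([-A(\ell+1/2)^{1/2},\,A(\ell+1/2)^{1/2}]^d)}=0 \quad\text{and}\quad \lim_{\ell\to\infty}\big\|f-\Psi_\ell\big\|_{L_\infty([-A(\ell+1/2)^{1/2},\,A(\ell+1/2)^{1/2}]^d)}=0 .$$ -/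

import Mathlib

open MeasureTheory Filter
open scoped Topology FourierTransform ENNReal InnerProductSpace

/-! ### Uniformly invertible Riesz bases -/

/-- A Riesz basis of a Hilbert space: a family which is the image of an orthonormal basis under an
onto isomorphism (a bounded linear bijection with bounded inverse). -/
def IsRieszBasis {ι H : Type*} [NormedAddCommGroup H] [InnerProductSpace ℂ H]
    (v : ι → H) : Prop :=
  ∃ (b : HilbertBasis ι ℂ H) (L : H ≃L[ℂ] H), ∀ n, L (b n) = v n

/-- The finite matrix of `P L P`, where `P` is the orthogonal projection onto the span of the
`e n`, `n ∈ S`, for an orthonormal basis `e`: the entry `(m, n)` is the `e m`-coefficient of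
`L (e n)`. -/
noncomputable def compressionMatrix {ι H : Type*} [NormedAddCommGroup H] [InnerProductSpace ℂ H]
    (e : ι → H) (L : H ≃L[ℂ] H) (S : Finset ι) : Matrix S S ℂ :=
  Matrix.of fun m n => inner ℂ (e m) (L (e n))

open scoped Matrix.Norms.L2Operator in
/-- `L` is uniformly invertible with respect to the projections `P ℓ`, `ℓ = 1, 2, …`, onto the
spans of the parts `S ℓ` of the orthonormal basis `e`: every finite matrix `P ℓ L P ℓ` is
invertible, and the inverses are bounded uniformly in `ℓ`. The norm is the operator norm of a
matrix with respect to the Euclidean norm. -/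
def IsUniformlyInvertible {ι H : Type*} [DecidableEq ι] [NormedAddCommGroup H]
    [InnerProductSpace ℂ H] (e : ι → H) (S : ℕ → Finset ι) (L : H ≃L[ℂ] H) : Prop :=
  ∃ M : ℝ, ∀ ℓ : ℕ, 1 ≤ ℓ →
    IsUnit (compressionMatrix e L (S ℓ)) ∧ ‖(compressionMatrix e L (S ℓ))⁻¹‖ ≤ M

/-- The Riesz basis `v` is uniformly invertible (with respect to the parts `S ℓ` of the orthonormal
basis `e`) if the isomorphism `L` with `L (e n) = v n` is. -/
def IsUniformlyInvertibleRieszBasis {ι H : Type*} [DecidableEq ι] [NormedAddCommGroup H]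
    [InnerProductSpace ℂ H] (e : ι → H) (S : ℕ → Finset ι) (v : ι → H) : Prop :=
  IsRieszBasis v ∧ ∃ L : H ≃L[ℂ] H, (∀ n, L (e n) = v n) ∧ IsUniformlyInvertible e S L

/-! ### Exponentials on the cube `[-π, π]^d` -/

/-- The closed cube `[-r, r]^d` in `ℝ^d`. -/
def cube (d : ℕ) (r : ℝ) : Set (EuclideanSpace ℝ (Fin d)) :=
  {x | ∀ i, x i ∈ Set.Icc (-r) r}

/-- Lebesgue measure on `[-π, π]^d`. -/
noncomputable def cubeMeasure (d : ℕ) : Measure (EuclideanSpace ℝ (Fin d)) :=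
  volume.restrict (cube d Real.pi)

/-- `x ↦ (2π)^(-d/2) exp(i ⟨x, τ⟩)`. -/
noncomputable def expFun {d : ℕ} (τ x : EuclideanSpace ℝ (Fin d)) : ℂ :=
  (((2 * Real.pi) ^ (-(d : ℝ) / 2) : ℝ) : ℂ) * Complex.exp (Complex.I * ((⟪x, τ⟫_ℝ : ℝ) : ℂ))

theorem cube_isCompact (d : ℕ) (r : ℝ) : IsCompact (cube d r) := by
  have h : cube d r = (EuclideanSpace.equiv (Fin d) ℝ).toHomeomorph ⁻¹'
      Set.pi Set.univ (fun _ => Set.Icc (-r) r) := by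
    ext x
    simp [cube, Pi.le_def, forall_and]
  rw [h, Homeomorph.isCompact_preimage]
  exact isCompact_univ_pi fun _ => isCompact_Icc

theorem expFun_memLp {d : ℕ} (τ : EuclideanSpace ℝ (Fin d)) :
    MemLp (expFun τ) 2 (cubeMeasure d) := by
  have hc : Continuous (expFun τ) := by
    unfold expFun
    fun_prop
  have : IsFiniteMeasure (cubeMeasure d) :=
    ⟨by simpa [cubeMeasure] using (cube_isCompact d Real.pi).measure_lt_top⟩
  refine MemLp.of_bound hc.aestronglyMeasurable ((2 * Real.pi) ^ (-(d : ℝ) / 2)) ?_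
  refine Eventually.of_forall fun x => le_of_eq ?_
  rw [expFun, norm_mul, mul_comm Complex.I, Complex.norm_exp_ofReal_mul_I, mul_one,
    Complex.norm_real, Real.norm_of_nonneg (by positivity)]

/-- The exponential with frequency `τ` as an element of `L_2([-π, π]^d)`. -/
noncomputable def expL2 {d : ℕ} (τ : EuclideanSpace ℝ (Fin d)) : Lp ℂ 2 (cubeMeasure d) :=
  (expFun_memLp τ).toLp (expFun τ)

/-- The point `n ∈ ℤ^d` of `ℝ^d`. -/
noncomputable def latticePoint {d : ℕ} (n : Fin d → ℤ) : EuclideanSpace ℝ (Fin d) :=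
  WithLp.toLp 2 fun i => (n i : ℝ)

/-- The index set `{-ℓ, …, ℓ}^d`. -/
noncomputable def indexCube (d ℓ : ℕ) : Finset (Fin d → ℤ) :=
  Fintype.piFinset fun _ => Finset.Icc (-(ℓ : ℤ)) (ℓ : ℤ)

/-- The exponentials with frequencies `t n`, `n ∈ ℤ^d`, form a uniformly invertible Riesz basis of
`L_2([-π, π]^d)`: the orthonormal basis is that of the exponentials with integer frequencies `n`,
and its finite parts are given by `n ∈ {-ℓ, …, ℓ}^d`. -/
def HasUniformlyInvertibleExponentials {d : ℕ}
    (t : (Fin d → ℤ) → EuclideanSpace ℝ (Fin d)) : Prop :=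
  IsUniformlyInvertibleRieszBasis (fun n : Fin d → ℤ => expL2 (latticePoint n)) (indexCube d)
    (fun n => expL2 (t n))

/-! ### Bandlimited functions -/

/-- The inverse Fourier transform on `L_2(ℝ^d)`, normalized as
`(2π)^(-d/2) ∫ f(ξ) exp(i ⟨x, ξ⟩) dξ`. Mathlib's `𝓕⁻` is `∫ f(ξ) exp(2πi ⟨x, ξ⟩) dξ` (extended
to `L_2`), hence the dilation by `2π`. -/
noncomputable def invFourier {d : ℕ}
    (f : Lp ℂ 2 (volume : Measure (EuclideanSpace ℝ (Fin d)))) (x : EuclideanSpace ℝ (Fin d)) : ℂ :=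
  (((2 * Real.pi) ^ (-(d : ℝ) / 2) : ℝ) : ℂ) *
    (𝓕⁻ f : Lp ℂ 2 (volume : Measure (EuclideanSpace ℝ (Fin d)))) ((2 * Real.pi)⁻¹ • x)

/-- The Paley–Wiener space `PW_{[-π, π]^d}`: functions in `L_2(ℝ^d)` whose inverse Fourier transform
is supported in `[-π, π]^d`. Each class in `L_2(ℝ^d)` of this kind contains exactly one continuous
function (it is the restriction of an entire function), and that function is meant. -/
structure IsPaleyWiener {d : ℕ} (f : EuclideanSpace ℝ (Fin d) → ℂ) : Prop where
  continuous : Continuous f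
  exists_memLp : ∃ hf : MemLp f 2 volume,
    ∀ᵐ x : EuclideanSpace ℝ (Fin d), x ∉ cube d Real.pi → invFourier (hf.toLp f) x = 0

/-! ### Interpolating polynomials -/

/-- The value of a polynomial in `d` variables at a point of `ℝ^d`. -/
noncomputable def polyEval {d : ℕ} (p : MvPolynomial (Fin d) ℂ)
    (x : EuclideanSpace ℝ (Fin d)) : ℂ :=
  MvPolynomial.eval (fun i => ((x i : ℝ) : ℂ)) p

/-- `p` has degree at most `2ℓ` in each coordinate, and `p (t n) = f (t n)` for all
`n ∈ {-ℓ, …, ℓ}^d`. -/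
def IsInterpolant {d : ℕ} (t : (Fin d → ℤ) → EuclideanSpace ℝ (Fin d))
    (f : EuclideanSpace ℝ (Fin d) → ℂ) (ℓ : ℕ) (p : MvPolynomial (Fin d) ℂ) : Prop :=
  (∀ i, p.degreeOf i ≤ 2 * ℓ) ∧ ∀ n ∈ indexCube d ℓ, polyEval p (t n) = f (t n)

/-! Write W_ℓ for `sincTailProd ℓ`. A Paley–Wiener function is ξ ↦ ⟨`expL2 ξ`, φ⟩ for some φ in
L²(cube) (`IsPaleyWiener.exists_eq_bandlimited`). For φ = e_m it is a product of shifted sincs. By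
Euler's product, if m ∈ {-ℓ,…,ℓ}^d, this is W_ℓ times a polynomial of degree at most 2ℓ in each
variable (`exists_bandlimited_expL2_eq`). Interpolating by polynomials therefore means finding γ_ℓ
in the span of these e_m with ⟨f_n, γ_ℓ⟩ = W_ℓ(t_n) f(t_n). The matrix of this system is the adjoint
of the compression matrix, so it is solvable; a dimension count gives uniqueness.

Since |W_ℓ| ≤ 1 and W_ℓ → 1 pointwise, the uniform bound on the inverses and dominated convergence
give γ_ℓ → φ (`tendsto_of_inner_eq_mul_inner`). So W_ℓ Ψ_ℓ → f on all of ℝ^d, in L² by Plancherel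
and uniformly by Cauchy–Schwarz.

It remains to divide by W_ℓ. As W_ℓ(x) ≥ exp(-2‖x‖²/ℓ), the quotient 1/W_ℓ is bounded on cubes of
side of order √ℓ, and there f (1/W_ℓ - 1) → 0 in both norms because f is in L² and vanishes at
infinity (`norm_sub_le_of_eq_sincTailProd_mul`). -/

/-! ### The tail of Euler's product for the sine -/

/-- The tail `∏_{k > ℓ} (1 - x² / k²)` of Euler's product. -/
noncomputable def sincTail (ℓ : ℕ) (x : ℝ) : ℝ :=
  ∏' k : ℕ, (1 - x ^ 2 / ((k : ℝ) + ℓ + 1) ^ 2)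

theorem summable_one_div_nat_add_sq (ℓ : ℕ) :
    Summable fun k : ℕ => 1 / ((k : ℝ) + ℓ + 1) ^ 2 := by
  have h := (summable_nat_add_iff (f := fun n : ℕ => 1 / (n : ℝ) ^ 2) (ℓ + 1)).2
    (Real.summable_one_div_nat_pow.2 one_lt_two)
  refine h.congr fun k => ?_
  push_cast
  ring_nf

theorem hasProdLocallyUniformlyOn_sincTail (ℓ : ℕ) :
    HasProdLocallyUniformlyOn (fun (k : ℕ) (x : ℝ) => 1 - x ^ 2 / ((k : ℝ) + ℓ + 1) ^ 2)
      (sincTail ℓ) Set.univ := by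
  refine hasProdLocallyUniformlyOn_of_forall_compact isOpen_univ fun K _ hK => ?_
  obtain ⟨R, hR⟩ := hK.exists_bound_of_continuousOn (f := fun x : ℝ => x ^ 2) (by fun_prop)
  have h := Summable.multipliableUniformlyOn_nat_one_add (R := ℝ)
    (f := fun (k : ℕ) (x : ℝ) => -(x ^ 2 / ((k : ℝ) + ℓ + 1) ^ 2)) hK
    (u := fun k : ℕ => R * (1 / ((k : ℝ) + ℓ + 1) ^ 2))
    ((summable_one_div_nat_add_sq ℓ).mul_left R)
    (Eventually.of_forall fun k x hx => by
      rw [norm_neg, norm_div, mul_one_div]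
      have := hR x hx
      rw [Real.norm_of_nonneg (by positivity : (0 : ℝ) ≤ ((k : ℝ) + ℓ + 1) ^ 2)]
      gcongr)
    (fun k => by fun_prop)
  simp only [← sub_eq_add_neg] at h
  exact h.hasProdUniformlyOn

theorem tendsto_prod_range_sincTail (ℓ : ℕ) (x : ℝ) :
    Tendsto (fun n : ℕ => ∏ k ∈ Finset.range n, (1 - x ^ 2 / ((k : ℝ) + ℓ + 1) ^ 2)) atTop
      (𝓝 (sincTail ℓ x)) :=
  ((hasProdLocallyUniformlyOn_sincTail ℓ).hasProd (Set.mem_univ x)).tendsto_prod_nat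

theorem continuous_sincTail (ℓ : ℕ) : Continuous (sincTail ℓ) := by
  rw [← continuousOn_univ]
  exact (hasProdLocallyUniformlyOn_sincTail ℓ).tendstoLocallyUniformlyOn_finsetRange.continuousOn
    (Frequently.of_forall fun n => by fun_prop)

theorem sin_pi_mul_eq_prod_mul_sincTail (ℓ : ℕ) (x : ℝ) :
    Real.sin (Real.pi * x) = Real.pi * x *
      (∏ j ∈ Finset.range ℓ, (1 - x ^ 2 / ((j : ℝ) + 1) ^ 2)) * sincTail ℓ x := by
  have h1 := (tendsto_add_atTop_iff_nat ℓ).2 (Real.tendsto_euler_sin_prod x)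
  refine tendsto_nhds_unique h1 (((tendsto_prod_range_sincTail ℓ x).const_mul _).congr fun n => ?_)
  rw [add_comm n ℓ, Finset.prod_range_add, ← mul_assoc]
  congr 1
  refine Finset.prod_congr rfl fun k _ => ?_
  push_cast
  ring_nf

/-- A single factor may be smaller than 1. Write each as (x - (j+1))(x + (j+1)) / (j+1)²: the
numbers x - (j+1) dominate ℓ - j, which are the j + 1 in reverse order. -/
theorem one_le_abs_prod_one_sub {ℓ : ℕ} {x : ℝ} (hx : (ℓ : ℝ) + 1 ≤ x) :
    1 ≤ |∏ j ∈ Finset.range ℓ, (1 - x ^ 2 / ((j : ℝ) + 1) ^ 2)| := by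
  have hj : ∀ j ∈ Finset.range ℓ, (j : ℝ) + 1 ≤ ℓ := fun j hj => by
    exact_mod_cast Finset.mem_range.1 hj
  have key : |∏ j ∈ Finset.range ℓ, (1 - x ^ 2 / ((j : ℝ) + 1) ^ 2)| =
      ((∏ j ∈ Finset.range ℓ, (x - (j + 1))) * ∏ j ∈ Finset.range ℓ, (x + (j + 1))) /
        ((∏ j ∈ Finset.range ℓ, ((j : ℝ) + 1)) * ∏ j ∈ Finset.range ℓ, ((j : ℝ) + 1)) := by
    rw [Finset.abs_prod, ← Finset.prod_mul_distrib, ← Finset.prod_mul_distrib,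
      ← Finset.prod_div_distrib]
    refine Finset.prod_congr rfl fun j h => ?_
    have h1 := hj j h
    have h2 : (0 : ℝ) < (j : ℝ) + 1 := by positivity
    have h3 : 1 - x ^ 2 / ((j : ℝ) + 1) ^ 2 =
        -((x - (j + 1)) * (x + (j + 1)) / (((j : ℝ) + 1) * (j + 1))) := by
      field_simp
      ring
    rw [h3, abs_neg, abs_of_nonneg]
    exact div_nonneg (mul_nonneg (by linarith) (by linarith)) (by positivity)
  rw [key, one_le_div (by positivity)]
  refine mul_le_mul ?_ ?_ (by positivity) (Finset.prod_nonneg fun j h => by linarith [hj j h])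
  · rw [← Finset.prod_range_reflect]
    refine Finset.prod_le_prod (fun j _ => by positivity) fun j h => ?_
    have h1 : ((ℓ - 1 - j : ℕ) : ℝ) = ℓ - 1 - j := by
      have := Finset.mem_range.1 h
      rw [Nat.sub_sub, Nat.cast_sub (by omega)]
      push_cast
      ring
    rw [h1]
    linarith
  · refine Finset.prod_le_prod (fun j _ => by positivity) fun j h => ?_
    linarith [hj j h, (Nat.cast_nonneg ℓ : (0 : ℝ) ≤ ℓ)]

theorem sincTail_abs (ℓ : ℕ) (x : ℝ) : sincTail ℓ |x| = sincTail ℓ x := by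
  simp [sincTail]

theorem sincTail_factor_mem {ℓ : ℕ} {x : ℝ} (hx : |x| ≤ ℓ + 1) (k : ℕ) :
    1 - x ^ 2 / ((k : ℝ) + ℓ + 1) ^ 2 ∈ Set.Icc (0 : ℝ) 1 := by
  constructor
  · rw [sub_nonneg, div_le_one (by positivity), sq_le_sq, abs_of_nonneg (a := (k : ℝ) + ℓ + 1)
      (by positivity)]
    linarith [(Nat.cast_nonneg k : (0 : ℝ) ≤ k)]
  · linarith [show 0 ≤ x ^ 2 / ((k : ℝ) + ℓ + 1) ^ 2 by positivity]

/-- Up to |x| = ℓ + 1 all factors lie in [0, 1]. Beyond that, the tail is sin(πx) divided by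
quantities of modulus at least 1. -/
theorem abs_sincTail_le_one (ℓ : ℕ) (x : ℝ) : |sincTail ℓ x| ≤ 1 := by
  rcases le_total |x| (ℓ + 1) with hx | hx
  · have h := fun k => sincTail_factor_mem hx k
    rw [abs_of_nonneg]
    · exact le_of_tendsto' (tendsto_prod_range_sincTail ℓ x) fun n =>
        Finset.prod_le_one (fun k _ => (h k).1) fun k _ => (h k).2
    · exact ge_of_tendsto' (tendsto_prod_range_sincTail ℓ x) fun n =>
        Finset.prod_nonneg fun k _ => (h k).1
  · have h1 := one_le_abs_prod_one_sub hx
    have h2 := Real.abs_sin_le_one (Real.pi * |x|)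
    rw [sin_pi_mul_eq_prod_mul_sincTail ℓ, abs_mul, abs_mul, sincTail_abs] at h2
    have h3 : 1 ≤ abs (Real.pi * |x|) := by
      rw [abs_of_nonneg (by positivity)]
      nlinarith [Real.pi_gt_three, (Nat.cast_nonneg ℓ : (0 : ℝ) ≤ ℓ)]
    calc |sincTail ℓ x| = 1 * |sincTail ℓ x| := (one_mul _).symm
      _ ≤ _ := mul_le_mul_of_nonneg_right (one_le_mul_of_one_le_of_one_le h3 h1) (abs_nonneg _)
      _ ≤ 1 := h2

theorem exp_neg_two_mul_le_one_sub {u : ℝ} (h0 : 0 ≤ u) (h1 : u ≤ 1 / 2) :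
    Real.exp (-2 * u) ≤ 1 - u := by
  have h2 : 1 + 2 * u ≤ Real.exp (2 * u) := by linarith [Real.add_one_le_exp (2 * u)]
  rw [neg_mul, Real.exp_neg, inv_le_comm₀ (Real.exp_pos _) (by linarith)]
  refine le_trans ?_ h2
  rw [inv_le_iff_one_le_mul₀ (by linarith)]
  nlinarith

/-- Each factor is at least exp(-2x²/(k+ℓ+1)²), because `hx` keeps the subtracted term below 1/2;
the exponents are summed by telescoping. -/
theorem exp_le_sincTail {ℓ : ℕ} (hℓ : 1 ≤ ℓ) {x : ℝ} (hx : 2 * x ^ 2 ≤ ((ℓ : ℝ) + 1) ^ 2) :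
    Real.exp (-2 * x ^ 2 / ℓ) ≤ sincTail ℓ x := by
  have hℓ' : (1 : ℝ) ≤ ℓ := by exact_mod_cast hℓ
  refine ge_of_tendsto' (tendsto_prod_range_sincTail ℓ x) fun n => ?_
  -- The telescoped sum over k < n replaces its limit 1/ℓ, so that the induction closes.
  suffices h : Real.exp (-2 * x ^ 2 * (1 / ℓ - 1 / (ℓ + n))) ≤
      ∏ k ∈ Finset.range n, (1 - x ^ 2 / ((k : ℝ) + ℓ + 1) ^ 2) by
    refine le_trans (Real.exp_le_exp.2 ?_) h
    have : 0 ≤ 2 * x ^ 2 * (1 / ((ℓ : ℝ) + n)) := by positivity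
    calc -2 * x ^ 2 / ℓ ≤ -2 * x ^ 2 / ℓ + 2 * x ^ 2 * (1 / ((ℓ : ℝ) + n)) := by linarith
      _ = _ := by ring
  induction n with
  | zero => simp
  | succ n ih =>
    rw [Finset.prod_range_succ]
    have hn : (0 : ℝ) ≤ n := Nat.cast_nonneg n
    have hu : x ^ 2 / ((n : ℝ) + ℓ + 1) ^ 2 ≤ 1 / 2 := by
      rw [div_le_iff₀ (by positivity)]
      nlinarith
    have h1 := exp_neg_two_mul_le_one_sub (by positivity) hu
    refine le_trans ?_ (mul_le_mul ih h1 (Real.exp_pos _).le ((Real.exp_pos _).le.trans ih))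
    rw [← Real.exp_add, Real.exp_le_exp]
    have h2 : 1 / ((n : ℝ) + ℓ + 1) ^ 2 ≤ 1 / ((ℓ : ℝ) + n) - 1 / (ℓ + (n + 1)) := by
      rw [div_sub_div _ _ (by positivity) (by positivity), div_le_div_iff₀ (by positivity)
        (by positivity)]
      nlinarith
    have h3 := mul_le_mul_of_nonneg_left h2 (by positivity : 0 ≤ 2 * x ^ 2)
    push_cast
    have h4 : x ^ 2 / ((n : ℝ) + ℓ + 1) ^ 2 = x ^ 2 * (1 / ((n : ℝ) + ℓ + 1) ^ 2) := by ring
    rw [h4]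
    nlinarith

theorem exists_mul_prod_one_sub_eq (ℓ : ℕ) :
    ∃ c : ℝ, ∀ x : ℝ, x * ∏ j ∈ Finset.range ℓ, (1 - x ^ 2 / ((j : ℝ) + 1) ^ 2) =
      c * ∏ j ∈ Finset.Icc (-(ℓ : ℤ)) ℓ, (x - j) := by
  induction ℓ with
  | zero => exact ⟨1, by simp⟩
  | succ ℓ ih =>
    obtain ⟨c, hc⟩ := ih
    -- The new factor is -(x - (ℓ+1))(x + (ℓ+1)) / (ℓ+1)².
    refine ⟨-c / ((ℓ : ℝ) + 1) ^ 2, fun x => ?_⟩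
    have hI : Finset.Icc (-((ℓ + 1 : ℕ) : ℤ)) ((ℓ + 1 : ℕ) : ℤ) =
        insert ((ℓ : ℤ) + 1) (insert (-((ℓ : ℤ) + 1)) (Finset.Icc (-(ℓ : ℤ)) ℓ)) := by
      ext j
      simp only [Finset.mem_Icc, Finset.mem_insert]
      push_cast
      omega
    rw [hI, Finset.prod_insert, Finset.prod_insert, Finset.prod_range_succ, ← mul_assoc, hc]
    · push_cast
      field_simp
      ring
    · simp only [Finset.mem_Icc]
      omega
    · simp only [Finset.mem_insert, Finset.mem_Icc]
      omega

/-- sin(π(x - k)) is ± sin(πx), and dividing by x - k removes one of the 2ℓ + 1 zeros of the finite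
part; a polynomial of degree 2ℓ remains. -/
theorem exists_sinc_eq_sincTail_mul {ℓ : ℕ} {k : ℤ} (hk : k ∈ Finset.Icc (-(ℓ : ℤ)) ℓ) :
    ∃ a : ℝ, ∀ x : ℝ, Real.sinc (Real.pi * (x - k)) =
      sincTail ℓ x * (a * ∏ j ∈ (Finset.Icc (-(ℓ : ℤ)) ℓ).erase k, (x - j)) := by
  obtain ⟨c, hc⟩ := exists_mul_prod_one_sub_eq ℓ
  refine ⟨(-1) ^ k * c, fun x => ?_⟩
  have hcont : Continuous fun x : ℝ => Real.sinc (Real.pi * (x - k)) :=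
    Real.continuous_sinc.comp (by fun_prop)
  have hcont' : Continuous fun x : ℝ => sincTail ℓ x *
      ((-1) ^ k * c * ∏ j ∈ (Finset.Icc (-(ℓ : ℤ)) ℓ).erase k, (x - j)) :=
    (continuous_sincTail ℓ).mul (by fun_prop)
  -- Division by x - k needs x ≠ k; continuity supplies the remaining point.
  refine congrFun (hcont.ext_on (dense_compl_singleton (k : ℝ)) hcont' fun y hy => ?_) x
  have hy' : y - k ≠ 0 := sub_ne_zero.2 hy
  have hprod := Finset.mul_prod_erase (Finset.Icc (-(ℓ : ℤ)) ℓ) (fun j : ℤ => y - (j : ℝ)) hk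
  have hs : Real.sin (Real.pi * (y - k)) = (-1) ^ k * Real.sin (Real.pi * y) := by
    rw [mul_sub, mul_comm Real.pi (k : ℝ), Real.sin_sub_int_mul_pi]
  simp only
  rw [Real.sinc_of_ne_zero (mul_ne_zero Real.pi_ne_zero hy'), hs,
    sin_pi_mul_eq_prod_mul_sincTail ℓ, mul_assoc Real.pi, hc, ← hprod]
  field_simp

/-! ### The Fourier transform of functions in `L¹ ∩ L²` -/

section Fourier

theorem continuous_fourier_of_integrable {E : Type*} [NormedAddCommGroup E]
    [InnerProductSpace ℝ E] [FiniteDimensional ℝ E] [MeasurableSpace E] [BorelSpace E] {u : E → ℂ}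
    (hu : Integrable u) : Continuous (𝓕 u) :=
  VectorFourier.fourierIntegral_continuous Real.continuous_fourierChar
    (innerSL ℝ).continuous₂ hu

/-- Both sides are tested against smooth compactly supported g; either transform can be moved onto
g, which leaves the same integral. -/
theorem coeFn_fourier_toLp {E : Type*} [NormedAddCommGroup E] [InnerProductSpace ℝ E]
    [FiniteDimensional ℝ E] [MeasurableSpace E] [BorelSpace E] {u : E → ℂ} (h1 : Integrable u)
    (h2 : MemLp u 2) :
    ((𝓕 (h2.toLp u) : Lp ℂ 2 (volume : Measure E)) : E → ℂ) =ᵐ[volume] 𝓕 u := by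
  refine ae_eq_of_integral_contDiff_smul_eq ((Lp.memLp _).locallyIntegrable one_le_two)
    (continuous_fourier_of_integrable h1).locallyIntegrable fun g g_smooth g_cpt => ?_
  have hg₁ : HasCompactSupport (Complex.ofRealCLM ∘ g) := g_cpt.comp_left rfl
  have hg₂ : ContDiff ℝ (⊤ : ℕ∞) (Complex.ofRealCLM ∘ g) := by fun_prop
  set G : SchwartzMap E ℂ := hg₁.toSchwartzMap hg₂ with hG
  have hGg : ∀ x, G x = (g x : ℂ) := fun x => by simp [hG]
  calc ∫ x, g x • (𝓕 (h2.toLp u) : Lp ℂ 2 (volume : Measure E)) x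
      = ∫ x, G x • (𝓕 (h2.toLp u) : Lp ℂ 2 (volume : Measure E)) x := by
        simp [hGg]
    _ = Lp.toTemperedDistribution (𝓕 (h2.toLp u) : Lp ℂ 2 (volume : Measure E)) G := by
        rw [Lp.toTemperedDistribution_apply]
    _ = ∫ x, (𝓕 G) x • (h2.toLp u) x := by
        rw [← Lp.fourier_toTemperedDistribution_eq, TemperedDistribution.fourier_apply,
          Lp.toTemperedDistribution_apply]
    _ = ∫ x, (𝓕 (G : E → ℂ)) x • u x := by
        refine integral_congr_ae ?_
        filter_upwards [h2.coeFn_toLp] with x hx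
        rw [hx, SchwartzMap.fourier_coe]
    _ = ∫ x, G x • (𝓕 u) x := by
        have h := VectorFourier.integral_fourierIntegral_smul_eq_flip (e := Real.fourierChar)
          (μ := (volume : Measure E)) (ν := (volume : Measure E)) (L := innerₗ E)
          (f := (G : E → ℂ)) (g := u) Real.continuous_fourierChar
          (innerSL ℝ).continuous₂ G.integrable h1
        rw [flip_innerₗ] at h
        exact h
    _ = _ := by simp [hGg]

theorem exists_eLpNorm_two_comp_smul_eq (E : Type*) [NormedAddCommGroup E] [InnerProductSpace ℝ E]
    [FiniteDimensional ℝ E] [MeasurableSpace E] [BorelSpace E] {r : ℝ} (hr : r ≠ 0) :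
    ∃ C : ℝ≥0∞, C ≠ ∞ ∧ ∀ g : E → ℂ,
      eLpNorm (fun x => g (r • x)) 2 (volume : Measure E) = C * eLpNorm g 2 volume := by
  refine ⟨ENNReal.ofReal |(r ^ Module.finrank ℝ E)⁻¹| ^ (1 / (2 : ℝ≥0∞)).toReal,
    ENNReal.rpow_ne_top_of_nonneg (by positivity) ENNReal.ofReal_ne_top, fun g => ?_⟩
  have h := (Homeomorph.smulOfNeZero (α := E) r hr).measurableEmbedding.eLpNorm_map_measure
    (g := g) (p := 2) (μ := (volume : Measure E))
  rw [← smul_eq_mul, ← eLpNorm_smul_measure_of_ne_top (by simp), ← Measure.map_addHaar_smul _ hr]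
  exact h.symm

end Fourier

/-! ### Bandlimited functions -/

section Bandlimited

/-- The bandlimited function `ξ ↦ (2π)^(-d/2) ∫ φ(x) exp(-i ⟨x, ξ⟩) dx`. -/
noncomputable def bandlimited {d : ℕ} (φ : Lp ℂ 2 (cubeMeasure d))
    (ξ : EuclideanSpace ℝ (Fin d)) : ℂ :=
  inner ℂ (expL2 ξ) φ

theorem measurableSet_cube (d : ℕ) (r : ℝ) : MeasurableSet (cube d r) :=
  (cube_isCompact d r).measurableSet

instance isFiniteMeasure_cubeMeasure (d : ℕ) : IsFiniteMeasure (cubeMeasure d) :=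
  ⟨by simpa [cubeMeasure] using (cube_isCompact d Real.pi).measure_lt_top⟩

theorem conj_expFun {d : ℕ} (ξ x : EuclideanSpace ℝ (Fin d)) :
    (starRingEnd ℂ) (expFun ξ x) = (((2 * Real.pi) ^ (-(d : ℝ) / 2) : ℝ) : ℂ) *
      Complex.exp (-(Complex.I * ((⟪x, ξ⟫_ℝ : ℝ) : ℂ))) := by
  rw [expFun, map_mul, Complex.conj_ofReal, ← Complex.exp_conj, map_mul, Complex.conj_I,
    Complex.conj_ofReal, neg_mul]

theorem inner_expL2 {d : ℕ} (ξ : EuclideanSpace ℝ (Fin d)) (φ : Lp ℂ 2 (cubeMeasure d)) :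
    inner ℂ (expL2 ξ) φ = ∫ x, (starRingEnd ℂ) (expFun ξ x) * φ x ∂cubeMeasure d := by
  rw [L2.inner_def]
  refine integral_congr_ae ?_
  filter_upwards [(expFun_memLp ξ).coeFn_toLp] with x hx
  rw [expL2, hx, RCLike.inner_apply, mul_comm]

theorem bandlimited_eq_fourier {d : ℕ} (φ : Lp ℂ 2 (cubeMeasure d))
    (ξ : EuclideanSpace ℝ (Fin d)) :
    bandlimited φ ξ = (((2 * Real.pi) ^ (-(d : ℝ) / 2) : ℝ) : ℂ) *
      𝓕 ((cube d Real.pi).indicator φ) ((2 * Real.pi)⁻¹ • ξ) := by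
  rw [bandlimited, inner_expL2]
  change ∫ x in cube d Real.pi, _ = _
  rw [← integral_indicator (measurableSet_cube _ _), Real.fourier_eq', ← integral_const_mul]
  congr 1
  ext x
  by_cases hx : x ∈ cube d Real.pi
  · rw [Set.indicator_of_mem hx, Set.indicator_of_mem hx, conj_expFun, smul_eq_mul, mul_assoc]
    congr 3
    rw [inner_smul_right]
    push_cast
    field_simp
  · simp [Set.indicator_of_notMem hx]

theorem memLp_indicator_cube {d : ℕ} (φ : Lp ℂ 2 (cubeMeasure d)) :
    MemLp ((cube d Real.pi).indicator φ) 2 volume :=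
  (memLp_indicator_iff_restrict (measurableSet_cube _ _)).2 (Lp.memLp φ)

theorem integrable_indicator_cube {d : ℕ} (φ : Lp ℂ 2 (cubeMeasure d)) :
    Integrable ((cube d Real.pi).indicator φ) volume :=
  (integrable_indicator_iff (measurableSet_cube _ _)).2 ((Lp.memLp φ).integrable one_le_two)

theorem continuous_bandlimited {d : ℕ} (φ : Lp ℂ 2 (cubeMeasure d)) :
    Continuous (bandlimited φ) := by
  rw [funext (bandlimited_eq_fourier φ)]
  exact continuous_const.mul
    ((continuous_fourier_of_integrable (integrable_indicator_cube φ)).comp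
      (continuous_const_smul _))

/-- The Riemann–Lebesgue lemma; it controls the uniform norm far from the origin. -/
theorem tendsto_bandlimited_cocompact {d : ℕ} (φ : Lp ℂ 2 (cubeMeasure d)) :
    Tendsto (bandlimited φ) (cocompact _) (𝓝 0) := by
  rw [funext (bandlimited_eq_fourier φ), ← mul_zero (((2 * Real.pi) ^ (-(d : ℝ) / 2) : ℝ) : ℂ)]
  refine Tendsto.const_mul _ ?_
  have h := tendsto_integral_exp_inner_smul_cocompact ((cube d Real.pi).indicator φ)
  exact h.comp (Homeomorph.smulOfNeZero ((2 * Real.pi)⁻¹)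
    (by positivity)).isClosedEmbedding.tendsto_cocompact

/-- Plancherel and a dilation. Only the finiteness of `C` is needed. -/
theorem exists_eLpNorm_bandlimited_le (d : ℕ) :
    ∃ C : ℝ≥0∞, C ≠ ∞ ∧ ∀ φ : Lp ℂ 2 (cubeMeasure d),
      eLpNorm (bandlimited φ) 2 volume ≤ C * ‖φ‖ₑ := by
  obtain ⟨C, hC, h⟩ := exists_eLpNorm_two_comp_smul_eq (EuclideanSpace ℝ (Fin d))
    (r := (2 * Real.pi)⁻¹) (by positivity)
  set κ : ℂ := (((2 * Real.pi) ^ (-(d : ℝ) / 2) : ℝ) : ℂ) with hκ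
  refine ⟨‖κ‖ₑ * C, ENNReal.mul_ne_top (by simp) hC, fun φ => ?_⟩
  have h1 : bandlimited φ = κ • fun ξ =>
      𝓕 ((cube d Real.pi).indicator φ) ((2 * Real.pi)⁻¹ • ξ) :=
    funext (bandlimited_eq_fourier φ)
  have h2 : eLpNorm (𝓕 ((cube d Real.pi).indicator φ)) 2 volume = ‖φ‖ₑ := by
    rw [← eLpNorm_congr_ae (coeFn_fourier_toLp (integrable_indicator_cube φ)
      (memLp_indicator_cube φ)), ← Lp.enorm_def]
    rw [← ofReal_norm, Lp.norm_fourier_eq, ofReal_norm, Lp.enorm_toLp,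
      eLpNorm_indicator_eq_eLpNorm_restrict (measurableSet_cube _ _), Lp.enorm_def]
    rfl
  rw [h1, eLpNorm_const_smul, h, h2, mul_assoc]

theorem integral_Icc_exp_mul_I (a : ℝ) :
    ∫ y in Set.Icc (-Real.pi) Real.pi, Complex.exp (Complex.I * ((y * a : ℝ) : ℂ)) =
      2 * Real.pi * (Real.sinc (Real.pi * a) : ℂ) := by
  rw [integral_Icc_eq_integral_Ioc, ← intervalIntegral.integral_of_le (by linarith [Real.pi_pos])]
  rcases eq_or_ne a 0 with rfl | ha
  · simp
    ring
  · have hc : Complex.I * (a : ℂ) ≠ 0 := mul_ne_zero Complex.I_ne_zero (by exact_mod_cast ha)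
    have h : ∀ y : ℝ, Complex.exp (Complex.I * ((y * a : ℝ) : ℂ)) =
        Complex.exp (Complex.I * (a : ℂ) * y) := fun y => by
      push_cast
      ring_nf
    simp_rw [h]
    rw [integral_exp_mul_complex hc, Real.sinc_of_ne_zero (mul_ne_zero Real.pi_ne_zero ha)]
    push_cast
    rw [Complex.sin, div_eq_iff hc]
    have hπ : (Real.pi : ℂ) ≠ 0 := by exact_mod_cast Real.pi_ne_zero
    have ha' : (a : ℂ) ≠ 0 := by exact_mod_cast ha
    rw [show Complex.I * (a : ℂ) * (Real.pi : ℂ) = (Real.pi : ℂ) * a * Complex.I by ring,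
      show Complex.I * (a : ℂ) * (-(Real.pi : ℂ)) = -((Real.pi : ℂ) * a) * Complex.I by ring]
    field_simp
    linear_combination (Complex.exp (Real.pi * a * Complex.I) -
      Complex.exp (-(Real.pi * a * Complex.I))) * Complex.I_sq

theorem inner_expL2_expL2 {d : ℕ} (τ σ : EuclideanSpace ℝ (Fin d)) :
    inner ℂ (expL2 τ) (expL2 σ) = ∏ i, (Real.sinc (Real.pi * (σ i - τ i)) : ℂ) := by
  have h1 : inner ℂ (expL2 τ) (expL2 σ) =
      ∫ x in cube d Real.pi, (starRingEnd ℂ) (expFun τ x) * expFun σ x := by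
    rw [inner_expL2]
    refine integral_congr_ae ?_
    filter_upwards [(expFun_memLp σ).coeFn_toLp] with x hx
    rw [← hx]
    rfl
  -- The two normalizations multiply to (2π)^(-d), shared out as one (2π)⁻¹ per coordinate, so that
  -- Fubini applies.
  set g : Fin d → ℝ → ℂ := fun i => (Set.Icc (-Real.pi) Real.pi).indicator fun y =>
    (2 * Real.pi : ℂ)⁻¹ * Complex.exp (Complex.I * ((y * (σ i - τ i) : ℝ) : ℂ)) with hg
  have hπ : (Real.pi : ℂ) ≠ 0 := by exact_mod_cast Real.pi_ne_zero
  have h2 : ∀ x, (cube d Real.pi).indicator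
      (fun x => (starRingEnd ℂ) (expFun τ x) * expFun σ x) x = ∏ i, g i (x i) := fun x => by
    by_cases hx : x ∈ cube d Real.pi
    · have hx' : ∀ i, g i (x i) = (2 * Real.pi : ℂ)⁻¹ *
          Complex.exp (Complex.I * ((x i * (σ i - τ i) : ℝ) : ℂ)) := fun i =>
        Set.indicator_of_mem (hx i) _
      rw [Set.indicator_of_mem hx, Finset.prod_congr rfl fun i _ => hx' i,
        Finset.prod_mul_distrib, ← Complex.exp_sum, conj_expFun, expFun, mul_mul_mul_comm,
        ← Complex.exp_add]
      congr 1
      · rw [Finset.prod_const, Finset.card_univ, Fintype.card_fin, ← Complex.ofReal_mul,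
          ← Real.rpow_add (by positivity)]
        rw [show -(d : ℝ) / 2 + -(d : ℝ) / 2 = -(d : ℝ) by ring, Real.rpow_neg (by positivity),
          Real.rpow_natCast]
        push_cast
        rw [inv_pow]
      · congr 1
        rw [← Finset.mul_sum, ← Complex.ofReal_sum]
        simp only [mul_sub, Finset.sum_sub_distrib, PiLp.inner_apply, RCLike.inner_apply,
          RCLike.conj_to_real]
        simp only [mul_comm (x _)]
        push_cast
        ring
    · rw [Set.indicator_of_notMem hx]
      obtain ⟨i, hi⟩ := not_forall.1 hx
      exact (Finset.prod_eq_zero (Finset.mem_univ i) (Set.indicator_of_notMem hi _)).symm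
  rw [h1, ← integral_indicator (measurableSet_cube _ _)]
  simp_rw [h2]
  have h3 := (PiLp.volume_preserving_ofLp (Fin d)).integral_comp
    (MeasurableEquiv.toLp 2 (Fin d → ℝ)).symm.measurableEmbedding (fun y => ∏ i, g i (y i))
  rw [h3, integral_fintype_prod_volume_eq_prod]
  refine Finset.prod_congr rfl fun i _ => ?_
  rw [hg, integral_indicator measurableSet_Icc, integral_const_mul, integral_Icc_exp_mul_I]
  field_simp

theorem norm_expL2 {d : ℕ} (ξ : EuclideanSpace ℝ (Fin d)) : ‖expL2 ξ‖ = 1 := by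
  have h := norm_sq_eq_re_inner (𝕜 := ℂ) (expL2 ξ)
  rw [inner_expL2_expL2] at h
  simp only [sub_self, mul_zero, Real.sinc_zero, Complex.ofReal_one, Finset.prod_const_one,
    RCLike.one_re] at h
  exact (pow_eq_one_iff_of_nonneg (norm_nonneg _) two_ne_zero).1 h

theorem orthonormal_expL2_latticePoint (d : ℕ) :
    Orthonormal ℂ fun n : Fin d → ℤ => expL2 (latticePoint n) := by
  refine ⟨fun n => norm_expL2 _, fun m n hmn => ?_⟩
  obtain ⟨i, hi⟩ := Function.ne_iff.1 hmn
  simp only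
  rw [inner_expL2_expL2]
  refine Finset.prod_eq_zero (Finset.mem_univ i) ?_
  have h : ((n i : ℝ) - m i) ≠ 0 := sub_ne_zero.2 (by exact_mod_cast hi.symm)
  have h' : Real.sin (Real.pi * ((n i : ℝ) - m i)) = 0 := by
    rw [mul_comm, ← Int.cast_sub, Real.sin_int_mul_pi]
  change ((Real.sinc (Real.pi * ((n i : ℝ) - m i)) : ℝ) : ℂ) = 0
  rw [Real.sinc_of_ne_zero (mul_ne_zero Real.pi_ne_zero h), h', zero_div, Complex.ofReal_zero]

theorem norm_bandlimited_le {d : ℕ} (φ : Lp ℂ 2 (cubeMeasure d))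
    (ξ : EuclideanSpace ℝ (Fin d)) : ‖bandlimited φ ξ‖ ≤ ‖φ‖ :=
  (norm_inner_le_norm _ _).trans (by rw [norm_expL2, one_mul])

/-- The inverse transform vanishes outside a bounded set, hence is integrable, and its Fourier
integral is a continuous function equal a.e. to the continuous f. The function φ is this inverse
transform, dilated and normalized. -/
theorem IsPaleyWiener.exists_eq_bandlimited {d : ℕ} {f : EuclideanSpace ℝ (Fin d) → ℂ}
    (hf : IsPaleyWiener f) : ∃ φ : Lp ℂ 2 (cubeMeasure d), f = bandlimited φ := by
  obtain ⟨hf2, hsupp⟩ := hf.exists_memLp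
  set κ : ℂ := (((2 * Real.pi) ^ (-(d : ℝ) / 2) : ℝ) : ℂ) with hκ
  have hκ0 : κ ≠ 0 := by
    rw [hκ, Complex.ofReal_ne_zero]
    positivity
  have hr : (2 * Real.pi)⁻¹ ≠ 0 := by positivity
  set G : Lp ℂ 2 (volume : Measure (EuclideanSpace ℝ (Fin d))) := 𝓕⁻ (hf2.toLp f) with hG
  set h : EuclideanSpace ℝ (Fin d) → ℂ := fun x => G ((2 * Real.pi)⁻¹ • x) with hh
  have h0 : ∀ᵐ x, x ∉ cube d Real.pi → h x = 0 := by
    filter_upwards [hsupp] with x hx hxc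
    exact (mul_eq_zero.1 (hx hxc)).resolve_left hκ0
  have hmem : MemLp h 2 volume := by
    obtain ⟨C, hC, hC'⟩ := exists_eLpNorm_two_comp_smul_eq (EuclideanSpace ℝ (Fin d)) hr
    refine ⟨(Lp.aestronglyMeasurable G).comp_quasiMeasurePreserving
      (Measure.quasiMeasurePreserving_smul _ hr), ?_⟩
    rw [hh, hC']
    exact ENNReal.mul_lt_top hC.lt_top (Lp.memLp G).2
  have hind : (cube d Real.pi).indicator h =ᵐ[volume] h := by
    filter_upwards [h0] with x hx
    by_cases hxc : x ∈ cube d Real.pi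
    · rw [Set.indicator_of_mem hxc]
    · rw [Set.indicator_of_notMem hxc, hx hxc]
  have hint : Integrable h volume := by
    refine Integrable.congr ?_ hind
    rw [integrable_indicator_iff (measurableSet_cube _ _)]
    exact MemLp.integrable one_le_two (μ := cubeMeasure d) (hmem.restrict _)
  have hGint : Integrable G volume := (integrable_comp_smul_iff volume G hr).1 hint
  have hfG : f = 𝓕 (G : EuclideanSpace ℝ (Fin d) → ℂ) := by
    rw [← hf.continuous.ae_eq_iff_eq volume (continuous_fourier_of_integrable hGint)]
    have h1 := coeFn_fourier_toLp hGint (Lp.memLp G)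
    rw [Lp.toLp_coeFn, hG, FourierTransform.fourier_fourierInv_eq] at h1
    exact hf2.coeFn_toLp.symm.trans h1
  have hmem' : MemLp (κ • h) 2 (cubeMeasure d) := (hmem.restrict _).const_smul κ
  refine ⟨hmem'.toLp _, funext fun ξ => ?_⟩
  have h1 : bandlimited (hmem'.toLp _) ξ =
      ∫ x, (starRingEnd ℂ) (expFun ξ x) * (κ * h x) := by
    rw [bandlimited, inner_expL2]
    have h2 : ∫ x, (starRingEnd ℂ) (expFun ξ x) * (hmem'.toLp (κ • h)) x ∂cubeMeasure d =
        ∫ x, (starRingEnd ℂ) (expFun ξ x) * (κ * h x) ∂cubeMeasure d := by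
      refine integral_congr_ae ?_
      filter_upwards [hmem'.coeFn_toLp] with x hx
      rw [hx, Pi.smul_apply, smul_eq_mul]
    rw [h2, cubeMeasure]
    refine setIntegral_eq_integral_of_ae_compl_eq_zero ?_
    filter_upwards [h0] with x hx hxc
    rw [hx hxc, mul_zero, mul_zero]
  have h3 := Measure.integral_comp_smul (volume : Measure (EuclideanSpace ℝ (Fin d)))
    (fun y => Complex.exp (((-2 * Real.pi * ⟪y, ξ⟫_ℝ : ℝ) : ℂ) * Complex.I) • G y)
    (2 * Real.pi)⁻¹
  rw [hfG, h1, Real.fourier_eq']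
  have h4 : ∀ x, (starRingEnd ℂ) (expFun ξ x) * (κ * h x) = κ ^ 2 *
      (Complex.exp (((-2 * Real.pi * ⟪(2 * Real.pi)⁻¹ • x, ξ⟫_ℝ : ℝ) : ℂ) * Complex.I) •
        G ((2 * Real.pi)⁻¹ • x)) := fun x => by
    rw [conj_expFun, inner_smul_left, smul_eq_mul, ← hκ]
    have h5 : (((-2 * Real.pi * ((starRingEnd ℝ) (2 * Real.pi)⁻¹ * ⟪x, ξ⟫_ℝ) : ℝ) : ℂ) *
        Complex.I) = -(Complex.I * ((⟪x, ξ⟫_ℝ : ℝ) : ℂ)) := by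
      rw [RCLike.conj_to_real]
      push_cast
      field_simp
    rw [h5]
    ring
  simp_rw [h4]
  rw [integral_const_mul, h3]
  -- κ² = (2π)^(-d) cancels the Jacobian of the dilation.
  have h6 : κ ^ 2 * ((|((2 * Real.pi)⁻¹ ^ Module.finrank ℝ (EuclideanSpace ℝ (Fin d)))⁻¹| : ℝ) : ℂ)
      = 1 := by
    rw [hκ, ← Complex.ofReal_pow, ← Complex.ofReal_mul, finrank_euclideanSpace_fin,
      abs_of_nonneg (by positivity), ← Real.rpow_natCast _ 2, ← Real.rpow_mul (by positivity)]
    rw [inv_pow, inv_inv, ← Real.rpow_natCast _ d, ← Real.rpow_add (by positivity)]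
    norm_num
  rw [Complex.real_smul, ← mul_assoc, h6, one_mul]

end Bandlimited

/-! ### Uniformly invertible operators -/

section UniformlyInvertible

/-- Since e n = L⁻¹ L₀ (b n), the family e is the image of a complete one under an isomorphism.
Completeness of the integer exponentials thus comes from the Riesz basis itself. -/
theorem topologicalClosure_span_range_eq_top_of_riesz {ι H : Type*} [NormedAddCommGroup H]
    [InnerProductSpace ℂ H] {e v : ι → H} (hv : IsRieszBasis v) (L : H ≃L[ℂ] H)
    (hL : ∀ n, L (e n) = v n) : (Submodule.span ℂ (Set.range e)).topologicalClosure = ⊤ := by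
  obtain ⟨b, L₀, hb⟩ := hv
  set T : H ≃L[ℂ] H := L₀.trans L.symm with hT
  have hTe : Set.range e = (T : H →L[ℂ] H) '' Set.range b := by
    rw [← Set.range_comp]
    congr 1
    ext n
    simp [hT, hb, ← hL]
  have h := DenseRange.topologicalClosure_map_submodule (f := (T : H →L[ℂ] H))
    T.surjective.denseRange b.dense_span
  rw [hTe]
  convert h using 2
  exact Submodule.span_image (T : H →ₗ[ℂ] H)

open scoped Matrix.Norms.L2Operator

variable {ι H : Type*} [NormedAddCommGroup H] [InnerProductSpace ℂ H]
  {e : ι → H} {L : H ≃L[ℂ] H} {S : Finset ι}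

/-- Sampling against the L (e n) acts on coefficients as the adjoint of the compression, so
invertibility and the norm of the inverse carry over. -/
theorem compressionMatrix_conjTranspose_mulVec (c : ι → ℂ) (n : S) :
    ((compressionMatrix e L S).conjTranspose.mulVec fun m => c m) n =
      inner ℂ (L (e n)) (∑ m ∈ S, c m • e m) := by
  rw [inner_sum, ← Finset.sum_coe_sort S, Matrix.mulVec, dotProduct]
  refine Finset.sum_congr rfl fun m _ => ?_
  rw [Matrix.conjTranspose_apply, compressionMatrix, Matrix.of_apply, inner_smul_right,
    ← inner_conj_symm (L (e n)) (e m), mul_comm]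
  rfl

variable [DecidableEq ι]

theorem exists_inner_sum_eq (hK : IsUnit (compressionMatrix e L S)) (b : ι → ℂ) :
    ∃ c : ι → ℂ, ∀ n ∈ S, inner ℂ (L (e n)) (∑ m ∈ S, c m • e m) = b n := by
  have hK' : IsUnit (compressionMatrix e L S).conjTranspose := hK.star
  obtain ⟨c, hc⟩ := (Matrix.mulVec_surjective_iff_isUnit.2 hK') fun n : S => b n
  refine ⟨fun m => if h : m ∈ S then c ⟨m, h⟩ else 0, fun n hn => ?_⟩
  have h := compressionMatrix_conjTranspose_mulVec (e := e) (L := L) (S := S)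
    (fun m => if h : m ∈ S then c ⟨m, h⟩ else 0) ⟨n, hn⟩
  simp only [Finset.coe_mem, dite_true, Subtype.coe_eta] at h
  rw [← h]
  exact congrFun hc ⟨n, hn⟩

theorem exists_inner_ne_zero (hK : IsUnit (compressionMatrix e L S)) {n : ι} (hn : n ∈ S) :
    ∃ c : ι → ℂ, inner ℂ (L (e n)) (∑ m ∈ S, c m • e m) ≠ 0 := by
  obtain ⟨c, hc⟩ := exists_inner_sum_eq hK fun _ => 1
  exact ⟨c, by rw [hc n hn]; exact one_ne_zero⟩

theorem norm_sum_smul_le (he : Orthonormal ℂ e) (hK : IsUnit (compressionMatrix e L S))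
    (c : ι → ℂ) :
    ‖∑ m ∈ S, c m • e m‖ ≤ ‖(compressionMatrix e L S)⁻¹‖ *
      √(∑ n ∈ S, ‖inner ℂ (L (e n)) (∑ m ∈ S, c m • e m)‖ ^ 2) := by
  set K := compressionMatrix e L S with hKdef
  set c' : S → ℂ := fun m => c m with hc'
  have h1 : ‖∑ m ∈ S, c m • e m‖ = ‖WithLp.toLp 2 c'‖ := by
    rw [EuclideanSpace.norm_eq, ← Real.sqrt_sq (norm_nonneg (∑ m ∈ S, c m • e m))]
    congr 1
    rw [← Finset.sum_coe_sort S fun m => c m • e m]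
    have he' : Orthonormal ℂ fun m : S => e m := he.comp _ Subtype.val_injective
    have h := he'.inner_sum c' c' Finset.univ
    rw [@norm_sq_eq_re_inner ℂ, h, map_sum]
    refine Finset.sum_congr rfl fun m _ => ?_
    rw [RCLike.conj_mul]
    norm_cast
  have h2 : K⁻¹.conjTranspose.mulVec (K.conjTranspose.mulVec c') = c' := by
    rw [Matrix.mulVec_mulVec, ← Matrix.conjTranspose_mul,
      Matrix.mul_nonsing_inv _ ((Matrix.isUnit_iff_isUnit_det _).1 hK), Matrix.conjTranspose_one,
      Matrix.one_mulVec]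
  have h3 := Matrix.l2_opNorm_mulVec K⁻¹.conjTranspose (WithLp.toLp 2 (K.conjTranspose.mulVec c'))
  rw [Matrix.l2_opNorm_conjTranspose] at h3
  simp only at h3
  rw [h2] at h3
  rw [h1]
  refine h3.trans_eq ?_
  congr 1
  rw [EuclideanSpace.norm_eq, ← Finset.sum_coe_sort S]
  congr 1
  refine Finset.sum_congr rfl fun n _ => ?_
  rw [← compressionMatrix_conjTranspose_mulVec]

/-- Compare with the partial sums P ℓ of φ. Tested against L (e n), the difference is (w - 1)⟨e n,
L*φ⟩ + ⟨e n, L*(φ - P ℓ)⟩. The first part is small in ℓ² by dominated convergence, the second by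
Bessel's inequality, and the bound `M` turns this into smallness of the difference. -/
theorem tendsto_of_inner_eq_mul_inner [CompleteSpace H] {S : ℕ → Finset ι}
    (he : Orthonormal ℂ e) (he' : (Submodule.span ℂ (Set.range e)).topologicalClosure = ⊤)
    (hS : Tendsto S atTop atTop) (hL : IsUniformlyInvertible e S L) (φ : H) {w : ℕ → ι → ℂ}
    (hw : ∀ ℓ n, ‖w ℓ n‖ ≤ 1) (hw' : ∀ n, Tendsto (fun ℓ => w ℓ n) atTop (𝓝 1))
    {c : ℕ → ι → ℂ} (hc : ∀ ℓ, 1 ≤ ℓ → ∀ n ∈ S ℓ,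
      inner ℂ (L (e n)) (∑ m ∈ S ℓ, c ℓ m • e m) = w ℓ n * inner ℂ (L (e n)) φ) :
    Tendsto (fun ℓ => ∑ m ∈ S ℓ, c ℓ m • e m) atTop (𝓝 φ) := by
  obtain ⟨M, hM⟩ := hL
  set P : ℕ → H := fun ℓ => ∑ m ∈ S ℓ, inner ℂ (e m) φ • e m with hP
  have hPφ : Tendsto P atTop (𝓝 φ) := by
    have h := ((HilbertBasis.mk he he'.ge).hasSum_repr φ).comp hS
    refine h.congr fun ℓ => ?_
    simp only [Function.comp_apply, hP, HilbertBasis.repr_apply_apply, HilbertBasis.coe_mk]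
  set A : H →L[ℂ] H := ContinuousLinearMap.adjoint (L : H →L[ℂ] H) with hA
  have hinner : ∀ n x, inner ℂ (L (e n)) x = inner ℂ (e n) (A x) := fun n x => by
    rw [hA, ContinuousLinearMap.adjoint_inner_right]
    rfl
  set b : ι → ℝ := fun n => ‖inner ℂ (e n) (A φ)‖ ^ 2 with hb
  have hbs : Summable b := he.inner_products_summable _
  set r : ℕ → ι → ℝ := fun ℓ n => ‖w ℓ n - 1‖ ^ 2 * b n with hr
  have hwb : ∀ ℓ n, ‖w ℓ n - 1‖ ^ 2 ≤ 4 := fun ℓ n => by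
    have h : ‖w ℓ n - 1‖ ≤ 2 := (norm_sub_le _ _).trans (by rw [norm_one]; linarith [hw ℓ n])
    nlinarith [norm_nonneg (w ℓ n - 1)]
  have hrb : ∀ ℓ n, r ℓ n ≤ 4 * b n := fun ℓ n =>
    mul_le_mul_of_nonneg_right (hwb ℓ n) (by positivity)
  have hr0 : ∀ ℓ n, 0 ≤ r ℓ n := fun ℓ n => by positivity
  have hrs : ∀ ℓ, Summable (r ℓ) := fun ℓ =>
    Summable.of_nonneg_of_le (hr0 ℓ) (hrb ℓ) (hbs.mul_left 4)
  have hrt : Tendsto (fun ℓ => ∑' n, r ℓ n) atTop (𝓝 0) := by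
    rw [← tsum_zero (α := ℝ) (β := ι)]
    refine tendsto_tsum_of_dominated_convergence (hbs.mul_left 4) (fun n => ?_)
      (Eventually.of_forall fun ℓ n => ?_)
    · have h := ((((hw' n).sub_const 1).norm).pow 2).mul_const (b n)
      simpa using h
    · rw [Real.norm_of_nonneg (hr0 ℓ n)]
      exact hrb ℓ n
  set s : ℕ → ℝ := fun ℓ => 2 * ∑' n, r ℓ n + 2 * ‖A (φ - P ℓ)‖ ^ 2 with hs
  have hst : Tendsto s atTop (𝓝 0) := by
    have h1 : Tendsto (fun ℓ => A (φ - P ℓ)) atTop (𝓝 0) := by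
      have h := (A.continuous.tendsto _).comp (hPφ.const_sub φ)
      rwa [sub_self, map_zero] at h
    have h2 := (hrt.const_mul 2).add ((h1.norm.pow 2).const_mul 2)
    rwa [norm_zero, zero_pow two_ne_zero, mul_zero, add_zero] at h2
  have key : ∀ ℓ, 1 ≤ ℓ → ‖∑ m ∈ S ℓ, c ℓ m • e m - P ℓ‖ ≤ M * √(s ℓ) := fun ℓ hℓ => by
    have h1 : ∑ m ∈ S ℓ, c ℓ m • e m - P ℓ = ∑ m ∈ S ℓ, (c ℓ m - inner ℂ (e m) φ) • e m := by
      simp only [hP, sub_smul, Finset.sum_sub_distrib]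
    have h2 := norm_sum_smul_le (L := L) he (hM ℓ hℓ).1 fun m => c ℓ m - inner ℂ (e m) φ
    rw [← h1] at h2
    refine h2.trans (mul_le_mul (hM ℓ hℓ).2 (Real.sqrt_le_sqrt ?_) (Real.sqrt_nonneg _)
      ((norm_nonneg _).trans (hM ℓ hℓ).2))
    have h3 : ∀ n ∈ S ℓ, ‖inner ℂ (L (e n)) (∑ m ∈ S ℓ, c ℓ m • e m - P ℓ)‖ ^ 2 ≤
        2 * r ℓ n + 2 * ‖inner ℂ (e n) (A (φ - P ℓ))‖ ^ 2 := fun n hn => by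
      have h4 : inner ℂ (L (e n)) (∑ m ∈ S ℓ, c ℓ m • e m - P ℓ) =
          (w ℓ n - 1) * inner ℂ (e n) (A φ) + inner ℂ (e n) (A (φ - P ℓ)) := by
        rw [inner_sub_right, hc ℓ hℓ n hn, ← hinner, ← hinner, inner_sub_right]
        ring
      have h5 : r ℓ n = ‖(w ℓ n - 1) * inner ℂ (e n) (A φ)‖ ^ 2 := by
        rw [norm_mul, mul_pow]
      rw [h4, h5]
      have h6 := norm_add_le ((w ℓ n - 1) * inner ℂ (e n) (A φ)) (inner ℂ (e n) (A (φ - P ℓ)))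
      have h7 := pow_le_pow_left₀ (norm_nonneg _) h6 2
      nlinarith [sq_nonneg (‖(w ℓ n - 1) * inner ℂ (e n) (A φ)‖ -
        ‖inner ℂ (e n) (A (φ - P ℓ))‖)]
    refine (Finset.sum_le_sum h3).trans ?_
    rw [Finset.sum_add_distrib, ← Finset.mul_sum, ← Finset.mul_sum]
    exact add_le_add
      (mul_le_mul_of_nonneg_left ((hrs ℓ).sum_le_tsum _ fun n _ => hr0 ℓ n) zero_le_two)
      (mul_le_mul_of_nonneg_left (he.sum_inner_products_le _) zero_le_two)
  have hdiff : Tendsto (fun ℓ => ∑ m ∈ S ℓ, c ℓ m • e m - P ℓ) atTop (𝓝 0) := by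
    refine squeeze_zero_norm' (eventually_atTop.2 ⟨1, key⟩) ?_
    have h := ((Real.continuous_sqrt.tendsto _).comp hst).const_mul M
    simpa using h
  simpa using hdiff.add hPφ

end UniformlyInvertible

/-! ### Polynomials of bounded degree in each variable -/

section Polynomials

theorem mem_restrictDegree_iff_degreeOf_le {σ : Type*} {p : MvPolynomial σ ℂ} {N : ℕ} :
    p ∈ MvPolynomial.restrictDegree σ ℂ N ↔ ∀ i, p.degreeOf i ≤ N := by
  simp only [MvPolynomial.mem_restrictDegree, MvPolynomial.degreeOf_le_iff]
  exact ⟨fun h i s hs => h s hs i, fun h s hs i => h i s hs⟩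

/-- The exponents of degree at most `N` in each of `d` variables. -/
noncomputable def boundedExponentsEquiv (d N : ℕ) :
    {s : Fin d →₀ ℕ | ∀ i, s i ≤ N} ≃ (Fin d → Fin (N + 1)) where
  toFun s i := ⟨s.1 i, Nat.lt_succ_of_le (s.2 i)⟩
  invFun g := ⟨Finsupp.equivFunOnFinite.symm fun i => (g i : ℕ), fun i => by
    simpa using Nat.le_of_lt_succ (g i).2⟩
  left_inv s := by
    ext i
    simp
  right_inv g := by
    ext i
    simp

theorem finite_restrictDegree (d N : ℕ) :
    Module.Finite ℂ (MvPolynomial.restrictDegree (Fin d) ℂ N) := by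
  have : Finite {s : Fin d →₀ ℕ | ∀ i, s i ≤ N} := Finite.of_equiv _ (boundedExponentsEquiv d N).symm
  exact Module.Finite.of_basis (MvPolynomial.basisRestrictSupport ℂ {s : Fin d →₀ ℕ | ∀ i, s i ≤ N})

theorem finrank_restrictDegree (d N : ℕ) :
    Module.finrank ℂ (MvPolynomial.restrictDegree (Fin d) ℂ N) = (N + 1) ^ d := by
  have h := Module.finrank_eq_nat_card_basis
    (MvPolynomial.basisRestrictSupport ℂ {s : Fin d →₀ ℕ | ∀ i, s i ≤ N})
  rw [Nat.card_congr (boundedExponentsEquiv d N)] at h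
  refine h.trans ?_
  simp

theorem card_indexCube (d ℓ : ℕ) : (indexCube d ℓ).card = (2 * ℓ + 1) ^ d := by
  rw [indexCube, Fintype.card_piFinset]
  simp only [Int.card_Icc, Finset.prod_const, Finset.card_univ, Fintype.card_fin]
  congr 1
  omega

/-- Evaluation of the polynomials of degree at most `N` in each variable at a family of points. -/
noncomputable def evalRestrictDegree {d : ℕ} {ι : Type*} (t : ι → EuclideanSpace ℝ (Fin d))
    (N : ℕ) (S : Finset ι) : MvPolynomial.restrictDegree (Fin d) ℂ N →ₗ[ℂ] S → ℂ :=
  LinearMap.pi fun n => (MvPolynomial.aeval fun i => ((t n i : ℝ) : ℂ)).toLinearMap ∘ₗ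
    Submodule.subtype _

theorem evalRestrictDegree_apply {d : ℕ} {ι : Type*} (t : ι → EuclideanSpace ℝ (Fin d))
    (N : ℕ) (S : Finset ι) (p : MvPolynomial.restrictDegree (Fin d) ℂ N) (n : S) :
    evalRestrictDegree t N S p n = polyEval p.1 (t n) := by
  rw [evalRestrictDegree, LinearMap.pi_apply, polyEval, ← MvPolynomial.aeval_eq_eval]
  rfl

/-- Polynomials and data both have dimension (2ℓ+1)^d, so solvability for all data forces
injectivity. -/
theorem existsUnique_isInterpolant_of_exists {d : ℕ}
    {t : (Fin d → ℤ) → EuclideanSpace ℝ (Fin d)} {ℓ : ℕ}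
    (h : ∀ f : (Fin d → ℤ) → ℂ, ∃ p : MvPolynomial (Fin d) ℂ, (∀ i, p.degreeOf i ≤ 2 * ℓ) ∧
      ∀ n ∈ indexCube d ℓ, polyEval p (t n) = f n)
    (f : EuclideanSpace ℝ (Fin d) → ℂ) :
    ∃! p : MvPolynomial (Fin d) ℂ, IsInterpolant t f ℓ p := by
  obtain ⟨p, hp⟩ := h fun n => f (t n)
  refine ⟨p, hp, fun q hq => ?_⟩
  set T := evalRestrictDegree t (2 * ℓ) (indexCube d ℓ) with hT
  have := finite_restrictDegree d (2 * ℓ)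
  have hsurj : Function.Surjective T := fun b => by
    obtain ⟨r, hr, hrb⟩ := h fun n => if hn : n ∈ indexCube d ℓ then b ⟨n, hn⟩ else 0
    refine ⟨⟨r, mem_restrictDegree_iff_degreeOf_le.2 hr⟩, funext fun n => ?_⟩
    rw [hT, evalRestrictDegree_apply, hrb n n.2, dif_pos n.2]
  have hrank : Module.finrank ℂ (MvPolynomial.restrictDegree (Fin d) ℂ (2 * ℓ)) =
      Module.finrank ℂ (indexCube d ℓ → ℂ) := by
    rw [finrank_restrictDegree, Module.finrank_fintype_fun_eq_card, Fintype.card_coe,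
      card_indexCube]
  have hinj := (LinearMap.injective_iff_surjective_of_finrank_eq_finrank hrank).2 hsurj
  have heq : T ⟨q, mem_restrictDegree_iff_degreeOf_le.2 hq.1⟩ =
      T ⟨p, mem_restrictDegree_iff_degreeOf_le.2 hp.1⟩ := funext fun n => by
    rw [hT, evalRestrictDegree_apply, evalRestrictDegree_apply, hq.2 n n.2, hp.2 n n.2]
  exact congrArg Subtype.val (hinj heq)

end Polynomials

/-! ### Bandlimited functions with finitely many exponentials -/

section Interpolation

/-- The product `∏ i, ∏_{k > ℓ} (1 - (x i)² / k²)`. -/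
noncomputable def sincTailProd {d : ℕ} (ℓ : ℕ) (x : EuclideanSpace ℝ (Fin d)) : ℝ :=
  ∏ i, sincTail ℓ (x i)

theorem abs_sincTailProd_le_one {d : ℕ} (ℓ : ℕ) (x : EuclideanSpace ℝ (Fin d)) :
    |sincTailProd ℓ x| ≤ 1 := by
  rw [sincTailProd, Finset.abs_prod]
  exact Finset.prod_le_one (fun i _ => abs_nonneg _) fun i _ => abs_sincTail_le_one ℓ (x i)

theorem exp_le_sincTailProd {d ℓ : ℕ} (hℓ : 1 ≤ ℓ) {x : EuclideanSpace ℝ (Fin d)}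
    (hx : ∀ i, 2 * x i ^ 2 ≤ ((ℓ : ℝ) + 1) ^ 2) :
    Real.exp (-2 * ‖x‖ ^ 2 / ℓ) ≤ sincTailProd ℓ x := by
  have h : Real.exp (-2 * ‖x‖ ^ 2 / ℓ) = ∏ i, Real.exp (-2 * x i ^ 2 / ℓ) := by
    rw [← Real.exp_sum, EuclideanSpace.real_norm_sq_eq, Finset.mul_sum, Finset.sum_div]
  rw [h]
  exact Finset.prod_le_prod (fun i _ => (Real.exp_pos _).le) fun i _ => exp_le_sincTail hℓ (hx i)

theorem tendsto_sincTailProd {d : ℕ} (x : EuclideanSpace ℝ (Fin d)) :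
    Tendsto (fun ℓ => sincTailProd ℓ x) atTop (𝓝 1) := by
  have h1 : Tendsto (fun ℓ : ℕ => Real.exp (-2 * ‖x‖ ^ 2 / ℓ)) atTop (𝓝 1) := by
    rw [← Real.exp_zero]
    exact (Real.continuous_exp.tendsto 0).comp
      (tendsto_const_nhds.div_atTop tendsto_natCast_atTop_atTop)
  refine tendsto_of_tendsto_of_tendsto_of_le_of_le' h1 tendsto_const_nhds ?_
    (Eventually.of_forall fun ℓ => (abs_le.1 (abs_sincTailProd_le_one ℓ x)).2)
  filter_upwards [eventually_ge_atTop 1,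
    tendsto_natCast_atTop_atTop.eventually (eventually_ge_atTop (2 * ‖x‖ ^ 2))] with ℓ h1 h2
  refine exp_le_sincTailProd h1 fun i => ?_
  have h3 : x i ^ 2 ≤ ‖x‖ ^ 2 := by
    rw [EuclideanSpace.real_norm_sq_eq]
    exact Finset.single_le_sum (f := fun i => x i ^ 2) (fun j _ => sq_nonneg _) (Finset.mem_univ i)
  have h4 : (1 : ℝ) ≤ ℓ := by exact_mod_cast h1
  nlinarith

theorem exists_bandlimited_expL2_eq {d ℓ : ℕ} {m : Fin d → ℤ} (hm : m ∈ indexCube d ℓ) :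
    ∃ p ∈ MvPolynomial.restrictDegree (Fin d) ℂ (2 * ℓ), ∀ x,
      bandlimited (expL2 (latticePoint m)) x = (sincTailProd ℓ x : ℂ) * polyEval p x := by
  have hm' : ∀ i, m i ∈ Finset.Icc (-(ℓ : ℤ)) ℓ := Fintype.mem_piFinset.1 hm
  choose a ha using fun i => exists_sinc_eq_sincTail_mul (hm' i)
  set q : Fin d → MvPolynomial (Fin d) ℂ := fun i => MvPolynomial.C ((a i : ℝ) : ℂ) *
    ∏ j ∈ (Finset.Icc (-(ℓ : ℤ)) ℓ).erase (m i), (MvPolynomial.X i - MvPolynomial.C (j : ℂ))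
    with hq
  have hdeg : ∀ i i', (q i).degreeOf i' ≤ if i' = i then 2 * ℓ else 0 := fun i i' => by
    refine (MvPolynomial.degreeOf_C_mul_le _ _ _).trans ?_
    refine (MvPolynomial.degreeOf_prod_le _ _ _).trans ?_
    have h1 : ∀ j ∈ (Finset.Icc (-(ℓ : ℤ)) ℓ).erase (m i),
        (MvPolynomial.X i - MvPolynomial.C (j : ℂ) : MvPolynomial (Fin d) ℂ).degreeOf i' ≤
          if i' = i then 1 else 0 := fun j _ => by
      refine (MvPolynomial.degreeOf_sub_le _ _ _).trans ?_
      rw [MvPolynomial.degreeOf_C, MvPolynomial.degreeOf_X]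
      simp
    refine (Finset.sum_le_card_nsmul _ _ _ h1).trans ?_
    -- 2ℓ + 1 integers with one erased: exactly 2ℓ linear factors, all in the variable X i.
    rw [Finset.card_erase_of_mem (hm' i), Int.card_Icc, smul_eq_mul]
    split_ifs <;> omega
  refine ⟨∏ i, q i, mem_restrictDegree_iff_degreeOf_le.2 fun i' => ?_, fun x => ?_⟩
  · refine (MvPolynomial.degreeOf_prod_le _ _ _).trans
      ((Finset.sum_le_sum fun i _ => hdeg i i').trans ?_)
    simp
  · rw [bandlimited, inner_expL2_expL2, sincTailProd, polyEval, map_prod, Complex.ofReal_prod,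
      ← Finset.prod_mul_distrib]
    refine Finset.prod_congr rfl fun i _ => ?_
    have h : Real.sinc (Real.pi * ((latticePoint m : EuclideanSpace ℝ (Fin d)) i - x i)) =
        Real.sinc (Real.pi * (x i - m i)) := by
      rw [← Real.sinc_neg]
      congr 1
      simp only [latticePoint]
      ring
    rw [h, ha i]
    simp [hq]

theorem exists_bandlimited_sum_eq {d : ℕ} (ℓ : ℕ) (c : (Fin d → ℤ) → ℂ) :
    ∃ p ∈ MvPolynomial.restrictDegree (Fin d) ℂ (2 * ℓ), ∀ x,
      bandlimited (∑ m ∈ indexCube d ℓ, c m • expL2 (latticePoint m)) x =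
        (sincTailProd ℓ x : ℂ) * polyEval p x := by
  choose! q hq hq' using fun m (hm : m ∈ indexCube d ℓ) => exists_bandlimited_expL2_eq hm
  refine ⟨∑ m ∈ indexCube d ℓ, c m • q m,
    Submodule.sum_mem _ fun m hm => Submodule.smul_mem _ _ (hq m hm), fun x => ?_⟩
  rw [bandlimited, inner_sum, polyEval, map_sum, Finset.mul_sum]
  refine Finset.sum_congr rfl fun m hm => ?_
  have h := hq' m hm x
  rw [bandlimited, polyEval] at h
  rw [inner_smul_right, h, MvPolynomial.smul_eval]
  ring

variable {d : ℕ} {t : (Fin d → ℤ) → EuclideanSpace ℝ (Fin d)}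
  {L : Lp ℂ 2 (cubeMeasure d) ≃L[ℂ] Lp ℂ 2 (cubeMeasure d)} {ℓ : ℕ}

/-- Otherwise every function from the span would vanish at t n, and the invertible adjoint matrix
would have a zero row. -/
theorem sincTailProd_ne_zero (hL : ∀ n, L (expL2 (latticePoint n)) = expL2 (t n))
    (hK : IsUnit (compressionMatrix (fun n => expL2 (latticePoint n)) L (indexCube d ℓ)))
    {n : Fin d → ℤ} (hn : n ∈ indexCube d ℓ) : sincTailProd ℓ (t n) ≠ 0 := by
  intro h0
  obtain ⟨c, hc⟩ := exists_inner_ne_zero hK hn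
  obtain ⟨p, _, hp⟩ := exists_bandlimited_sum_eq ℓ c
  refine hc ?_
  have h := hp (t n)
  rw [h0, Complex.ofReal_zero, zero_mul, bandlimited, ← hL] at h
  exact h

theorem exists_bandlimited_eq_mul_polyEval
    (hL : ∀ n, L (expL2 (latticePoint n)) = expL2 (t n))
    (hK : IsUnit (compressionMatrix (fun n => expL2 (latticePoint n)) L (indexCube d ℓ)))
    (b : (Fin d → ℤ) → ℂ) :
    ∃ (c : (Fin d → ℤ) → ℂ) (p : MvPolynomial (Fin d) ℂ), (∀ i, p.degreeOf i ≤ 2 * ℓ) ∧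
      (∀ x, bandlimited (∑ m ∈ indexCube d ℓ, c m • expL2 (latticePoint m)) x =
        (sincTailProd ℓ x : ℂ) * polyEval p x) ∧
      ∀ n ∈ indexCube d ℓ, polyEval p (t n) = b n := by
  obtain ⟨c, hc⟩ := exists_inner_sum_eq hK fun n => (sincTailProd ℓ (t n) : ℂ) * b n
  obtain ⟨p, hp, hpc⟩ := exists_bandlimited_sum_eq ℓ c
  refine ⟨c, p, mem_restrictDegree_iff_degreeOf_le.1 hp, hpc, fun n hn => ?_⟩
  have h1 := hc n hn
  rw [hL] at h1
  have h2 := (hpc (t n)).symm.trans h1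
  exact mul_left_cancel₀ (Complex.ofReal_ne_zero.2 (sincTailProd_ne_zero hL hK hn)) h2

theorem existsUnique_isInterpolant (hL : ∀ n, L (expL2 (latticePoint n)) = expL2 (t n))
    (hK : IsUnit (compressionMatrix (fun n => expL2 (latticePoint n)) L (indexCube d ℓ)))
    (f : EuclideanSpace ℝ (Fin d) → ℂ) :
    ∃! p : MvPolynomial (Fin d) ℂ, IsInterpolant t f ℓ p :=
  existsUnique_isInterpolant_of_exists (fun b => by
    obtain ⟨_, p, hp, _, hpb⟩ := exists_bandlimited_eq_mul_polyEval hL hK b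
    exact ⟨p, hp, hpb⟩) f

theorem monotone_indexCube (d : ℕ) : Monotone (indexCube d) := fun a b hab => by
  refine Fintype.piFinset_subset _ _ fun _ => Finset.Icc_subset_Icc ?_ ?_ <;> omega

theorem tendsto_indexCube (d : ℕ) : Tendsto (indexCube d) atTop atTop := by
  refine tendsto_atTop_finset_of_monotone (monotone_indexCube d) fun n => ?_
  refine ⟨∑ i, (n i).natAbs, Fintype.mem_piFinset.2 fun i => ?_⟩
  have h := Finset.single_le_sum (f := fun i => (n i).natAbs) (fun _ _ => Nat.zero_le _)
    (Finset.mem_univ i)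
  simp only [Finset.mem_Icc] at h ⊢
  omega

/-- Uniqueness identifies Ψ ℓ with the polynomial factor of the solution of the weighted system; the
weights are w ℓ n = W_ℓ(t n). -/
theorem exists_tendsto_bandlimited_eq (ht : HasUniformlyInvertibleExponentials t)
    (φ : Lp ℂ 2 (cubeMeasure d)) {Ψ : ℕ → MvPolynomial (Fin d) ℂ}
    (hΨ : ∀ ℓ, 1 ≤ ℓ → IsInterpolant t (bandlimited φ) ℓ (Ψ ℓ)) :
    ∃ γ : ℕ → Lp ℂ 2 (cubeMeasure d), Tendsto γ atTop (𝓝 φ) ∧ ∀ ℓ, 1 ≤ ℓ → ∀ x,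
      bandlimited (γ ℓ) x = (sincTailProd ℓ x : ℂ) * polyEval (Ψ ℓ) x := by
  obtain ⟨hv, L, hL, hU⟩ := ht
  have hK := fun ℓ hℓ => (hU.choose_spec ℓ hℓ).1
  choose! c p hp hpc hpt using fun ℓ (hℓ : 1 ≤ ℓ) =>
    exists_bandlimited_eq_mul_polyEval hL (hK ℓ hℓ) fun n => bandlimited φ (t n)
  have hpΨ : ∀ ℓ, 1 ≤ ℓ → p ℓ = Ψ ℓ := fun ℓ hℓ =>
    (existsUnique_isInterpolant hL (hK ℓ hℓ) (bandlimited φ)).unique ⟨hp ℓ hℓ, hpt ℓ hℓ⟩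
      (hΨ ℓ hℓ)
  refine ⟨fun ℓ => ∑ m ∈ indexCube d ℓ, c ℓ m • expL2 (latticePoint m), ?_, fun ℓ hℓ x => ?_⟩
  · refine tendsto_of_inner_eq_mul_inner (orthonormal_expL2_latticePoint d)
      (topologicalClosure_span_range_eq_top_of_riesz hv L hL) (tendsto_indexCube d) hU φ
      (w := fun ℓ n => (sincTailProd ℓ (t n) : ℂ)) (fun ℓ n => ?_) (fun n => ?_)
      fun ℓ hℓ n hn => ?_
    · rw [Complex.norm_real]
      exact abs_sincTailProd_le_one ℓ (t n)
    · exact (Complex.continuous_ofReal.tendsto 1).comp (tendsto_sincTailProd (t n))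
    · have h := hpc ℓ hℓ (t n)
      rw [hpt ℓ hℓ n hn] at h
      rw [hL]
      exact h
  · rw [hpc ℓ hℓ x, hpΨ ℓ hℓ]

end Interpolation

/-! ### Division by the tail of the sine product -/

section Correction

theorem tendsto_eLpNorm_two_of_dominated {α : Type*} [MeasurableSpace α] {μ : Measure α}
    {F : ℕ → α → ℝ} {g : α → ℝ} (hF : ∀ n, AEStronglyMeasurable (F n) μ) (hg : MemLp g 2 μ)
    (hFg : ∀ n x, ‖F n x‖ ≤ ‖g x‖) (hF0 : ∀ x, Tendsto (fun n => F n x) atTop (𝓝 0)) :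
    Tendsto (fun n => eLpNorm (F n) 2 μ) atTop (𝓝 0) := by
  simp only [eLpNorm_eq_lintegral_rpow_enorm_toReal two_ne_zero ENNReal.ofNat_ne_top]
  have hfin : ∫⁻ x, ‖g x‖ₑ ^ (2 : ℝ≥0∞).toReal ∂μ ≠ ∞ :=
    (lintegral_rpow_enorm_lt_top_of_eLpNorm_lt_top two_ne_zero ENNReal.ofNat_ne_top hg.2).ne
  have h := tendsto_lintegral_of_dominated_convergence' (μ := μ)
    (F := fun n x => ‖F n x‖ₑ ^ (2 : ℝ≥0∞).toReal) (f := fun _ => 0)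
    (fun x => ‖g x‖ₑ ^ (2 : ℝ≥0∞).toReal) (fun n => (hF n).enorm.pow_const _)
    (fun n => Eventually.of_forall fun x =>
      ENNReal.rpow_le_rpow (enorm_le_iff_norm_le.2 (hFg n x)) ENNReal.toReal_nonneg) hfin
    (Eventually.of_forall fun x => by
      have h1 := (hF0 x).enorm
      rw [enorm_zero] at h1
      have h2 := (ENNReal.continuous_rpow_const (y := (2 : ℝ≥0∞).toReal)).tendsto 0 |>.comp h1
      rwa [ENNReal.zero_rpow_of_pos (by simp)] at h2)
  rw [lintegral_zero] at h
  have h2 := (ENNReal.continuous_rpow_const (y := 1 / (2 : ℝ≥0∞).toReal)).tendsto 0 |>.comp h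
  rwa [ENNReal.zero_rpow_of_pos (by simp)] at h2

variable {d : ℕ}

/-- The bound `min (exp (2 ‖x‖² / ℓ) - 1) B` of `1 / sincTailProd ℓ x - 1`. -/
noncomputable def tailCorrection (B : ℝ) (ℓ : ℕ) (x : EuclideanSpace ℝ (Fin d)) : ℝ :=
  min (Real.exp (2 * ‖x‖ ^ 2 / ℓ) - 1) B

theorem tailCorrection_nonneg {B : ℝ} (hB : 0 ≤ B) (ℓ : ℕ) (x : EuclideanSpace ℝ (Fin d)) :
    0 ≤ tailCorrection B ℓ x :=
  le_min (by rw [sub_nonneg]; exact Real.one_le_exp (by positivity)) hB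

theorem continuous_tailCorrection (B : ℝ) (ℓ : ℕ) :
    Continuous (tailCorrection B ℓ : EuclideanSpace ℝ (Fin d) → ℝ) := by
  unfold tailCorrection
  fun_prop

theorem tendsto_exp_div_sub_one (r : ℝ) :
    Tendsto (fun ℓ : ℕ => Real.exp (r / ℓ) - 1) atTop (𝓝 0) := by
  have h := (Real.continuous_exp.tendsto 0).comp
    (tendsto_const_nhds (x := r).div_atTop tendsto_natCast_atTop_atTop)
  rw [Real.exp_zero] at h
  have h' := h.sub_const 1
  rwa [sub_self] at h'

theorem tendsto_tailCorrection {B : ℝ} (hB : 0 ≤ B) (x : EuclideanSpace ℝ (Fin d)) :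
    Tendsto (fun ℓ => tailCorrection B ℓ x) atTop (𝓝 0) :=
  squeeze_zero (fun ℓ => tailCorrection_nonneg hB ℓ x) (fun _ => min_le_left _ _)
    (tendsto_exp_div_sub_one _)

/-- Capping the correction at `B` gives the majorant B‖f‖ on the whole space, so the growing cubes
play no role in the limit. -/
theorem tendsto_eLpNorm_mul_tailCorrection {f : EuclideanSpace ℝ (Fin d) → ℂ}
    (hf : MemLp f 2 volume) {B : ℝ} (hB : 0 ≤ B) :
    Tendsto (fun ℓ => eLpNorm (fun x => ‖f x‖ * tailCorrection B ℓ x) 2 volume) atTop (𝓝 0) := by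
  refine tendsto_eLpNorm_two_of_dominated (g := fun x => ‖f x‖ * B)
    (fun ℓ => hf.1.norm.mul (continuous_tailCorrection B ℓ).aestronglyMeasurable)
    (hf.norm.mul_const B) (fun ℓ x => ?_) fun x => ?_
  · have h0 := tailCorrection_nonneg hB ℓ x
    rw [Real.norm_of_nonneg (by positivity), Real.norm_of_nonneg (by positivity)]
    exact mul_le_mul_of_nonneg_left (min_le_right _ _) (norm_nonneg _)
  · simpa using (tendsto_tailCorrection hB x).const_mul ‖f x‖

/-- Off a compact set f is small and the correction is at most `B`; on it f is bounded and the
correction tends to 0 uniformly. -/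
theorem eventually_norm_mul_tailCorrection_le {f : EuclideanSpace ℝ (Fin d) → ℂ} {K : ℝ}
    (hK : ∀ x, ‖f x‖ ≤ K) (hf : Tendsto f (cocompact _) (𝓝 0)) {B : ℝ} (hB : 0 ≤ B)
    {ε : ℝ} (hε : 0 < ε) : ∀ᶠ ℓ : ℕ in atTop, ∀ x, ‖f x‖ * tailCorrection B ℓ x ≤ ε := by
  have hf' : ∀ᶠ x in cocompact (EuclideanSpace ℝ (Fin d)), ‖f x‖ < ε / (B + 1) := by
    have h := hf.norm
    rw [norm_zero] at h
    exact h.eventually (gt_mem_nhds (by positivity))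
  obtain ⟨T, hT, hTf⟩ := mem_cocompact.1 hf'
  obtain ⟨R, hR⟩ := hT.isBounded.exists_norm_le
  have hK0 : 0 ≤ K := (norm_nonneg _).trans (hK 0)
  filter_upwards [(tendsto_exp_div_sub_one (2 * R ^ 2)).eventually
    (ge_mem_nhds (show 0 < ε / (K + 1) by positivity))] with ℓ hℓ x
  have hdiv : ∀ {y z : ℝ}, 0 ≤ z → y ≤ ε / (z + 1) → z * y ≤ ε := fun {y z} hz hy => by
    rw [le_div_iff₀ (by positivity)] at hy
    rcases le_total 0 y with h | h <;> nlinarith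
  by_cases hx : x ∈ T
  · refine (mul_le_mul_of_nonneg_right (hK x) (tailCorrection_nonneg hB ℓ x)).trans
      (hdiv hK0 ((min_le_left _ _).trans (le_trans ?_ hℓ)))
    have h := hR x hx
    gcongr
  · refine (mul_le_mul_of_nonneg_left (min_le_right _ _) (norm_nonneg _)).trans ?_
    rw [mul_comm]
    exact hdiv hB (le_of_lt (hTf hx))

/-- With W = W_ℓ(x), u - ψ = W⁻¹(u - g) - (W⁻¹ - 1)u. On the cube ‖x‖² ≤ dA²(ℓ + 1/2) ≤ 2dA²ℓ,
whence W⁻¹ ≤ exp(4dA²). -/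
theorem norm_sub_le_of_eq_sincTailProd_mul {A : ℝ} {ℓ : ℕ} (hℓ : 1 ≤ ℓ)
    (hA : 2 * A ^ 2 ≤ ℓ) {x : EuclideanSpace ℝ (Fin d)}
    (hx : x ∈ cube d (A * ((ℓ : ℝ) + 1 / 2) ^ ((1 : ℝ) / 2))) {u g ψ : ℂ}
    (hg : g = (sincTailProd ℓ x : ℂ) * ψ) :
    ‖u - ψ‖ ≤ Real.exp (4 * d * A ^ 2) * ‖u - g‖ +
      ‖u‖ * tailCorrection (Real.exp (4 * d * A ^ 2)) ℓ x := by
  have hℓ' : (1 : ℝ) ≤ ℓ := by exact_mod_cast hℓ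
  have hx2 : ∀ i, x i ^ 2 ≤ A ^ 2 * (ℓ + 1 / 2) := fun i => by
    have h := sq_le_sq' (hx i).1 (hx i).2
    rwa [mul_pow, ← Real.sqrt_eq_rpow, Real.sq_sqrt (by positivity)] at h
  have hW : Real.exp (-2 * ‖x‖ ^ 2 / ℓ) ≤ sincTailProd ℓ x :=
    -- 2(x i)² ≤ 2A²(ℓ + 1/2) ≤ ℓ(ℓ + 1/2) by `hA`.
    exp_le_sincTailProd hℓ fun i => by nlinarith [hx2 i]
  set W := sincTailProd ℓ x with hWdef
  have hW0 : 0 < W := (Real.exp_pos _).trans_le hW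
  have hW1 : W ≤ 1 := (abs_le.1 (abs_sincTailProd_le_one ℓ x)).2
  have hinv : W⁻¹ ≤ Real.exp (2 * ‖x‖ ^ 2 / ℓ) := by
    rw [inv_le_comm₀ hW0 (Real.exp_pos _), ← Real.exp_neg]
    rwa [← neg_div, ← neg_mul]
  have hnorm : ‖x‖ ^ 2 ≤ 2 * d * A ^ 2 * ℓ := by
    rw [EuclideanSpace.real_norm_sq_eq]
    refine (Finset.sum_le_card_nsmul _ _ _ fun i _ => hx2 i).trans ?_
    rw [Finset.card_univ, Fintype.card_fin, nsmul_eq_mul]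
    have h : 0 ≤ (d : ℝ) * A ^ 2 := by positivity
    nlinarith
  have hexp : Real.exp (2 * ‖x‖ ^ 2 / ℓ) ≤ Real.exp (4 * d * A ^ 2) := by
    rw [Real.exp_le_exp, div_le_iff₀ (by positivity)]
    linarith
  have hcorr : W⁻¹ - 1 ≤ tailCorrection (Real.exp (4 * d * A ^ 2)) ℓ x :=
    le_min (by linarith) (by linarith)
  have hone : 1 ≤ W⁻¹ := (one_le_inv₀ hW0).2 hW1
  have hWC : (W : ℂ) ≠ 0 := Complex.ofReal_ne_zero.2 hW0.ne'
  have heq : u - ψ = ((W⁻¹ : ℝ) : ℂ) * (u - g) - ((W⁻¹ - 1 : ℝ) : ℂ) * u := by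
    rw [hg]
    push_cast
    field_simp
    ring
  rw [heq]
  refine (norm_sub_le _ _).trans ?_
  rw [norm_mul, norm_mul, Complex.norm_real, Complex.norm_real,
    Real.norm_of_nonneg (by positivity), Real.norm_of_nonneg (by linarith), mul_comm _ ‖u‖]
  exact add_le_add (mul_le_mul_of_nonneg_right (hinv.trans hexp) (norm_nonneg _))
    (mul_le_mul_of_nonneg_left hcorr (norm_nonneg _))

end Correction

/-! ### Convergence of the interpolating polynomials -/

theorem memLp_bandlimited {d : ℕ} (φ : Lp ℂ 2 (cubeMeasure d)) :
    MemLp (bandlimited φ) 2 volume := by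
  obtain ⟨C, hC, h⟩ := exists_eLpNorm_bandlimited_le d
  exact ⟨(continuous_bandlimited φ).aestronglyMeasurable,
    (h φ).trans_lt (ENNReal.mul_lt_top hC.lt_top enorm_lt_top)⟩

theorem bandlimited_sub {d : ℕ} (φ γ : Lp ℂ 2 (cubeMeasure d)) (x : EuclideanSpace ℝ (Fin d)) :
    bandlimited (φ - γ) x = bandlimited φ x - bandlimited γ x :=
  inner_sub_right _ _ _

theorem corollary5p2 (d : ℕ) (hd : 1 ≤ d) (t : (Fin d → ℤ) → EuclideanSpace ℝ (Fin d))
    (ht : HasUniformlyInvertibleExponentials t)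
    (f : EuclideanSpace ℝ (Fin d) → ℂ) (hf : IsPaleyWiener f) :
    (∀ ℓ : ℕ, 1 ≤ ℓ → ∃! p : MvPolynomial (Fin d) ℂ, IsInterpolant t f ℓ p) ∧
    ∀ Ψ : ℕ → MvPolynomial (Fin d) ℂ, (∀ ℓ : ℕ, 1 ≤ ℓ → IsInterpolant t f ℓ (Ψ ℓ)) →
      ∀ A : ℝ, 0 < A →
        Tendsto (fun ℓ : ℕ => eLpNorm (fun x => f x - polyEval (Ψ ℓ) x) 2
          (volume.restrict (cube d (A * ((ℓ : ℝ) + 1 / 2) ^ ((1 : ℝ) / 2))))) atTop (𝓝 0) ∧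
        Tendsto (fun ℓ : ℕ => eLpNorm (fun x => f x - polyEval (Ψ ℓ) x) ∞
          (volume.restrict (cube d (A * ((ℓ : ℝ) + 1 / 2) ^ ((1 : ℝ) / 2))))) atTop (𝓝 0) := by
  refine ⟨fun ℓ hℓ => ?_, fun Ψ hΨ A hA => ?_⟩
  · obtain ⟨_, L, hL, M, hM⟩ := ht
    exact existsUnique_isInterpolant hL (hM ℓ hℓ).1 f
  obtain ⟨φ, rfl⟩ := hf.exists_eq_bandlimited
  obtain ⟨γ, hγ, hγΨ⟩ := exists_tendsto_bandlimited_eq ht φ hΨ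
  set B : ℝ := Real.exp (4 * d * A ^ 2) with hB
  have hB0 : 0 ≤ B := (Real.exp_pos _).le
  have hdist : Tendsto (fun ℓ => ‖φ - γ ℓ‖) atTop (𝓝 0) := by
    simpa using (hγ.const_sub φ).norm
  have hbound : ∀ᶠ ℓ : ℕ in atTop, ∀ x ∈ cube d (A * ((ℓ : ℝ) + 1 / 2) ^ ((1 : ℝ) / 2)),
      ‖bandlimited φ x - polyEval (Ψ ℓ) x‖ ≤ B * ‖bandlimited (φ - γ ℓ) x‖ +
        ‖bandlimited φ x‖ * tailCorrection B ℓ x := by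
    filter_upwards [eventually_ge_atTop 1, tendsto_natCast_atTop_atTop.eventually
      (eventually_ge_atTop (2 * A ^ 2))] with ℓ h1 h2 x hx
    rw [bandlimited_sub]
    exact norm_sub_le_of_eq_sincTailProd_mul h1 h2 hx (hγΨ ℓ h1 x)
  constructor
  · obtain ⟨C, hC, hC'⟩ := exists_eLpNorm_bandlimited_le d
    have hlim : Tendsto (fun ℓ => ‖B‖ₑ * (C * ‖φ - γ ℓ‖ₑ) +
        eLpNorm (fun x => ‖bandlimited φ x‖ * tailCorrection B ℓ x) 2 volume) atTop (𝓝 0) := by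
      have h1 : Tendsto (fun ℓ => ‖φ - γ ℓ‖ₑ) atTop (𝓝 0) := by
        simpa using (hγ.const_sub φ).enorm
      have h2 := ENNReal.Tendsto.const_mul (a := ‖B‖ₑ)
        (ENNReal.Tendsto.const_mul (a := C) h1 (Or.inr hC)) (Or.inr enorm_ne_top)
      simpa using h2.add (tendsto_eLpNorm_mul_tailCorrection (memLp_bandlimited φ) hB0)
    refine tendsto_of_tendsto_of_tendsto_of_le_of_le' tendsto_const_nhds hlim
      (Eventually.of_forall fun _ => zero_le) ?_
    filter_upwards [hbound] with ℓ hℓ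
    have h1 := eLpNorm_mono_ae_real (p := 2)
      ((ae_restrict_iff' (μ := volume) (measurableSet_cube d _)).2 (Eventually.of_forall hℓ))
    -- The majorant is defined everywhere, so its norm may be taken over ℝ^d.
    refine (h1.trans (eLpNorm_mono_measure _ Measure.restrict_le_self)).trans ?_
    refine (eLpNorm_add_le
      (continuous_const.mul (continuous_bandlimited _).norm).aestronglyMeasurable
      ((continuous_bandlimited φ).norm.mul (continuous_tailCorrection B ℓ)).aestronglyMeasurable
      one_le_two).trans (add_le_add ?_ le_rfl)
    refine (eLpNorm_const_smul B (fun x => ‖bandlimited (φ - γ ℓ) x‖) 2 volume).trans_le ?_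
    rw [eLpNorm_norm]
    gcongr
    exact hC' _
  · rw [ENNReal.tendsto_nhds_zero]
    intro ε hε
    -- A real tolerance below ε, which may be ∞.
    obtain ⟨δ, hδ, hδε⟩ : ∃ δ : ℝ, 0 < δ ∧ ENNReal.ofReal δ ≤ ε := by
      rcases eq_or_ne ε ∞ with rfl | htop
      · exact ⟨1, one_pos, le_top⟩
      · exact ⟨ε.toReal, ENNReal.toReal_pos hε.ne' htop, (ENNReal.ofReal_toReal htop).le⟩
    have h1 := (hdist.const_mul B).eventually (ge_mem_nhds (show B * 0 < δ / 2 by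
      rw [mul_zero]; positivity))
    filter_upwards [hbound, h1, eventually_norm_mul_tailCorrection_le (norm_bandlimited_le φ)
      (tendsto_bandlimited_cocompact φ) hB0 (half_pos hδ)] with ℓ hℓ h2 h3
    rw [eLpNorm_exponent_top]
    refine (eLpNormEssSup_le_of_ae_bound ((ae_restrict_iff' (measurableSet_cube d _)).2
      (Eventually.of_forall fun x hx => (hℓ x hx).trans ?_))).trans hδε
    have h4 := mul_le_mul_of_nonneg_left (norm_bandlimited_le (φ - γ ℓ) x) hB0
    linarith [h3 x]
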